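/- **Setting.** Let $C_f=\{c_0,\dots,c_{m-1}\}$ be a set of $m$ (pairwise distinct) Boolean functions $c:\{-1,1\}^n\to\{0,1\}$, where for variables $-1$ stands for True and $+1$ for False. The Walsh–Fourier expansion of $c$ is the polynomial $$\mathrm{WFE}_c(x)=\sum_{S\subseteq[n]}\hat c(S)\prod_{i\in S}x_i,\qquad \hat c(S)=2^{-n}\sum_{y\in\{\pm1\}^n}c(y)\prod_{i\in S}y_i ,$$ and for $w:C_f\to\mathbb R$ the objective is $F_{f,w}(x)=\sum_{c\in C_f}w(c)\,\mathrm{WFE}_c(x)$. A multi-rooted BDD (MRBDD) $B$ of $C_f$ is an ordered binary decision diagram (not necessarily reduced) with node set $V$, one terminal $B.\mathrm{one}$ and one terminal $B.\mathrm{zero}$, and for each $c\in C_f$ a node $B.\mathrm{entry}(c)$ that is the root of a BDD of $c$. Each non-terminal node $v$ has a variable index $i_v$, a True child $v.T$ and a False child $v.F$; $E$ is the set of True and False edges, and $S(B)=|V|+|E|$. **Algorithm (Efficient Gradient Computation).** Input: $B$, $a\in[-1,1]^n$, $w$. 1. Set $g:=0\in\mathbb R^n$. 2. *Top-down:* set $M_{TD}:=0$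 on $V$, then $M_{TD}[B.\mathrm{entry}(c)]:=w(c)$ for each $c\in C_f$. Sort $V$ topologically. For each non-terminal $v$, parents before children, do $M_{TD}[v.T]\mathrel{+}=\frac{1-a_{i_v}}2M_{TD}[v]$ and $M_{TD}[v.F]\mathrel{+}=\frac{1+a_{i_v}}2M_{TD}[v]$. 3. *Bottom-up:* set $M_{BU}:=0$ on $V$, then $M_{BU}[B.\mathrm{one}]:=1$. Sort $V$ topologically. For each $v$, children before parents, do $M_{BU}[u]\mathrel{+}=\frac{1-a_{i_u}}2M_{BU}[v]$ for each $u$ with $u.T=v$ and $M_{BU}[u]\mathrel{+}=\frac{1+a_{i_u}}2M_{BU}[v]$ for each $u$ with $u.F=v$. 4. For each non-terminal $v$ do $g[i_v]\mathrel{+}=\frac12 M_{TD}[v]\cdot(M_{BU}[v.F]-M_{BU}[v.T])$. Return $g$. The topological sort is Kahn's algorithm, and the parents of a node are found through linked lists that are built in one pass over the nodes. Time is the number of steps on a random access machine with exact real arithmetic, on which each operation on reals or indices, each memory access and each test takes one step; the memory holds the input $(B,a,w)$ and is otherwise arbitrary at the start. **Theorem.** There is an absolute constant $C$ such that for every such $C_f$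 and $w$, every MRBDD $B$ of $C_f$ and every $a\in[-1,1]^n$, the algorithm halts, and: * its output is the exact gradient, $g=\nabla F_{f,w}(a)$; * the final messages satisfy, for all nodes $v$, $$M_{TD}[v]=\sum_{c:\,B.\mathrm{entry}(c)=v}w(c)+\sum_{u:\,u.T=v}\tfrac{1-a_{i_u}}2M_{TD}[u]+\sum_{u:\,u.F=v}\tfrac{1+a_{i_u}}2M_{TD}[u],$$ $M_{BU}[B.\mathrm{one}]=1$, $M_{BU}[B.\mathrm{zero}]=0$, and $M_{BU}[v]=\tfrac{1-a_{i_v}}2M_{BU}[v.T]+\tfrac{1+a_{i_v}}2M_{BU}[v.F]$ for non-terminal $v$; * for each variable $i$, $$g_i=\tfrac12\sum_{v:\ i_v=i}M_{TD}[v]\cdot\bigl(M_{BU}[v.F]-M_{BU}[v.T]\bigr);$$ * it takes at most $C\cdot(S(B)+n)$ steps, and at most $C\cdot S(B)$ steps if every one of the $n$ variables labels some node of $B$. -/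

import Mathlib

namespace GradBDD

/-! ## Boolean functions, Walsh-Fourier expansion, objective -/

/-- Boolean functions of `n` variables. On the Boolean cube, `True` is encoded by `-1` and `False`
by `+1` (see `sgn`); as a value, `True` is encoded by `1` and `False` by `0`. -/
abbrev BoolFun (n : ℕ) := (Fin n → Bool) → Bool

/-- The encoding of truth values of variables: `True ↦ -1`, `False ↦ +1`. -/
def sgn (b : Bool) : ℝ := if b then -1 else 1

/-- The Walsh-Fourier coefficient of `f` at the set `S` of variables. -/
noncomputable def fourierCoeff {n : ℕ} (f : BoolFun n) (S : Finset (Fin n)) : ℝ :=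
  (1 / 2 ^ n) * ∑ x : Fin n → Bool, (if f x then 1 else 0) * ∏ i ∈ S, sgn (x i)

/-- The Walsh-Fourier expansion of `f`, as a (multilinear polynomial) function on `ℝⁿ`. -/
noncomputable def wfe {n : ℕ} (f : BoolFun n) (x : EuclideanSpace ℝ (Fin n)) : ℝ :=
  ∑ S : Finset (Fin n), fourierCoeff f S * ∏ i ∈ S, x i

/-- The objective `F_{f,w}` for the constraints `c 0, …, c (m-1)` with weights `w`. -/
noncomputable def objective {n m : ℕ} (c : Fin m → BoolFun n) (w : Fin m → ℝ)
    (x : EuclideanSpace ℝ (Fin n)) : ℝ :=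
  ∑ j, w j * wfe (c j) x

/-! ## Multi-rooted binary decision diagrams -/

/-- The content of a node of a BDD with `N` nodes over `n` variables: one of the two terminals, or
a decision node with its variable index, its `True` child and its `False` child. -/
inductive Cell (n N : ℕ) where
  | zero
  | one
  | branch (i : Fin n) (t f : Fin N)

/-- A multi-rooted (ordered) BDD over `n` variables with nodes `0, …, N-1` and `m` entries. It has
exactly one terminal of each kind, and along every edge between decision nodes the
variable strictly increases in a fixed variable order. -/
structure MRBDD (n m N : ℕ) where
  cell : Fin N → Cell n N
  zero : Fin N
  one : Fin N
  entry : Fin m → Fin N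
  cell_zero_iff : ∀ v, cell v = Cell.zero ↔ v = zero
  cell_one_iff : ∀ v, cell v = Cell.one ↔ v = one
  order : Equiv.Perm (Fin n)
  ordered : ∀ v i t f, cell v = Cell.branch i t f →
    ∀ u, u = t ∨ u = f → ∀ j t' f', cell u = Cell.branch j t' f' → order i < order j

namespace MRBDD

variable {n m N : ℕ} (B : MRBDD n m N)

/-- An upper bound for the length of the paths that start at `v` (used for termination only). -/
def rank (v : Fin N) : ℕ :=
  match B.cell v with
  | Cell.branch i _ _ => n - (B.order i : ℕ)
  | _ => 0

theorem rank_child {v : Fin N} {i : Fin n} {t f : Fin N} (h : B.cell v = Cell.branch i t f)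
    {u : Fin N} (hu : u = t ∨ u = f) : B.rank u < B.rank v := by
  have hi := (B.order i).isLt
  cases hc : B.cell u with
  | zero => simp only [rank, h, hc]; omega
  | one => simp only [rank, h, hc]; omega
  | branch j t' f' =>
    have hlt : (B.order i : ℕ) < (B.order j : ℕ) := B.ordered v i t f h u hu j t' f' hc
    simp only [rank, h, hc]
    omega

/-- The value at the assignment `x` of the Boolean function with root `v`: follow the path that `x`
determines from `v` down to a terminal. -/
def eval (x : Fin n → Bool) (v : Fin N) : Bool :=
  match h : B.cell v with
  | Cell.zero => false
  | Cell.one => true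
  | Cell.branch i t f => if x i then eval x t else eval x f
termination_by B.rank v
decreasing_by
  · exact B.rank_child h (Or.inl rfl)
  · exact B.rank_child h (Or.inr rfl)

/-- `B` is an MRBDD of the constraints `c`: the `j`-th entry is the root of a BDD of `c j`. -/
def Represents (c : Fin m → BoolFun n) : Prop :=
  ∀ j x, B.eval x (B.entry j) = c j x

/-- `v` is not a terminal. -/
def Nonterminal (v : Fin N) : Prop := v ≠ B.zero ∧ v ≠ B.one

instance (v : Fin N) : Decidable (B.Nonterminal v) :=
  inferInstanceAs (Decidable (v ≠ B.zero ∧ v ≠ B.one))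

/-- The edge set: each decision node has a `True` edge and a `False` edge. -/
def edges : Finset (Fin N × Bool) := Finset.univ.filter fun e => B.Nonterminal e.1

/-- The size `S(B) = |V| + |E|`. -/
def size : ℕ := N + B.edges.card

/-- The variable `i` labels some node of `B`. -/
def Occurs (i : Fin n) : Prop := ∃ v t f, B.cell v = Cell.branch i t f

/-- The equations for the top-down messages at the point `a` with weights `w`: a node receives the
weight of the entries at it and, through each of its incoming edges, the message of the parent
times the probability of the edge. -/
def IsTopDown (a : EuclideanSpace ℝ (Fin n)) (w : Fin m → ℝ) (M : Fin N → ℝ) : Prop :=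
  ∀ v, M v = (∑ j, if B.entry j = v then w j else 0) +
    ∑ u, match B.cell u with
      | Cell.branch i t f =>
          (if t = v then (1 - a i) / 2 * M u else 0) + (if f = v then (1 + a i) / 2 * M u else 0)
      | _ => 0

/-- The equations for the bottom-up messages at the point `a`. -/
def IsBottomUp (a : EuclideanSpace ℝ (Fin n)) (M : Fin N → ℝ) : Prop :=
  ∀ v, M v = match B.cell v with
    | Cell.zero => 0
    | Cell.one => 1
    | Cell.branch i t f => (1 - a i) / 2 * M t + (1 + a i) / 2 * M f

/-- The sum over the nodes `v` labelled `i` of `MTD[v] * (MBU[v.F] - MBU[v.T])`. -/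
noncomputable def combine (MTD MBU : Fin N → ℝ) (i : Fin n) : ℝ :=
  ∑ v, match B.cell v with
    | Cell.branch k t f => if k = i then MTD v * (MBU f - MBU t) else 0
    | _ => 0

end MRBDD

/-! ## A real random access machine with a step count

Programs of a small imperative language with natural number (index) variables and arrays, and
real variables and arrays. The available operations are addition and truncated subtraction of
indices, comparison of indices, the field operations on reals, and reading and writing a variable or
an array cell. Every node of the syntax tree of an expression that is evaluated, every
assignment and every test counts as one step. -/

/-- Index variables. The first five hold inputs. -/
inductive NVar where
  | numVars | numNodes | numConstr | zero | one
  | i | j | u | v | k | head | len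
deriving DecidableEq

/-- Real variables (the values that the two evaluation algorithms return). -/
inductive RVar where
  | valTD | valBU
deriving DecidableEq

/-- Index arrays. The first four hold inputs. -/
inductive NArr where
  | label | childT | childF | entry
  | inDeg | list | headT | headF | nextT | nextF
deriving DecidableEq

/-- Real arrays. The first two hold inputs. -/
inductive RArr where
  | a | w
  | mTD | mBU | g
deriving DecidableEq

/-- The memory. -/
structure Store where
  nat : NVar → ℕ
  real : RVar → ℝ
  natArr : NArr → ℕ → ℕ
  realArr : RArr → ℕ → ℝ

/-- Index expressions. -/
inductive NExp where
  | const (c : ℕ)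
  | var (x : NVar)
  | get (A : NArr) (e : NExp)
  | add (e₁ e₂ : NExp)
  | sub (e₁ e₂ : NExp)

namespace NExp

def eval (s : Store) : NExp → ℕ
  | const c => c
  | var x => s.nat x
  | get A e => s.natArr A (e.eval s)
  | add e₁ e₂ => e₁.eval s + e₂.eval s
  | sub e₁ e₂ => e₁.eval s - e₂.eval s

def cost : NExp → ℕ
  | const _ => 1
  | var _ => 1
  | get _ e => e.cost + 1
  | add e₁ e₂ => e₁.cost + e₂.cost + 1
  | sub e₁ e₂ => e₁.cost + e₂.cost + 1

end NExp

/-- Real expressions. -/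
inductive RExp where
  | const (c : ℕ)
  | var (x : RVar)
  | get (A : RArr) (e : NExp)
  | add (e₁ e₂ : RExp)
  | sub (e₁ e₂ : RExp)
  | mul (e₁ e₂ : RExp)
  | div (e₁ e₂ : RExp)

namespace RExp

noncomputable def eval (s : Store) : RExp → ℝ
  | const c => (c : ℝ)
  | var x => s.real x
  | get A e => s.realArr A (e.eval s)
  | add e₁ e₂ => e₁.eval s + e₂.eval s
  | sub e₁ e₂ => e₁.eval s - e₂.eval s
  | mul e₁ e₂ => e₁.eval s * e₂.eval s
  | div e₁ e₂ => e₁.eval s / e₂.eval s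

def cost : RExp → ℕ
  | const _ => 1
  | var _ => 1
  | get _ e => e.cost + 1
  | add e₁ e₂ => e₁.cost + e₂.cost + 1
  | sub e₁ e₂ => e₁.cost + e₂.cost + 1
  | mul e₁ e₂ => e₁.cost + e₂.cost + 1
  | div e₁ e₂ => e₁.cost + e₂.cost + 1

end RExp

/-- Tests. -/
inductive BExp where
  | eq (e₁ e₂ : NExp)
  | lt (e₁ e₂ : NExp)

namespace BExp

def eval (s : Store) : BExp → Bool
  | eq e₁ e₂ => decide (e₁.eval s = e₂.eval s)
  | lt e₁ e₂ => decide (e₁.eval s < e₂.eval s)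

def cost : BExp → ℕ
  | eq e₁ e₂ => e₁.cost + e₂.cost + 1
  | lt e₁ e₂ => e₁.cost + e₂.cost + 1

end BExp

namespace Store

def setN (s : Store) (x : NVar) (c : ℕ) : Store :=
  { s with nat := Function.update s.nat x c }

def setR (s : Store) (x : RVar) (r : ℝ) : Store :=
  { s with real := Function.update s.real x r }

def storeN (s : Store) (A : NArr) (p c : ℕ) : Store :=
  { s with natArr := Function.update s.natArr A (Function.update (s.natArr A) p c) }

def storeR (s : Store) (A : RArr) (p : ℕ) (r : ℝ) : Store :=
  { s with realArr := Function.update s.realArr A (Function.update (s.realArr A) p r) }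

end Store

/-- Programs. -/
inductive Prog where
  | skip
  | setN (x : NVar) (e : NExp)
  | setR (x : RVar) (e : RExp)
  | storeN (A : NArr) (p e : NExp)
  | storeR (A : RArr) (p : NExp) (e : RExp)
  | seq (P Q : Prog)
  | ite (b : BExp) (P Q : Prog)
  | loop (b : BExp) (P : Prog)

/-- `Exec P s t s'`: the program `P`, started with memory `s`, halts after exactly `t` steps with
memory `s'`. Here `loop b P` is the loop "while `b` do `P`". -/
inductive Exec : Prog → Store → ℕ → Store → Prop where
  | skip (s) : Exec Prog.skip s 1 s
  | setN (s x e) : Exec (Prog.setN x e) s (e.cost + 1) (s.setN x (e.eval s))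
  | setR (s x e) : Exec (Prog.setR x e) s (e.cost + 1) (s.setR x (e.eval s))
  | storeN (s A p e) :
      Exec (Prog.storeN A p e) s (p.cost + e.cost + 1) (s.storeN A (p.eval s) (e.eval s))
  | storeR (s A p e) :
      Exec (Prog.storeR A p e) s (p.cost + e.cost + 1) (s.storeR A (p.eval s) (e.eval s))
  | seq {P Q s t₁ s₁ t₂ s₂} (h₁ : Exec P s t₁ s₁) (h₂ : Exec Q s₁ t₂ s₂) :
      Exec (Prog.seq P Q) s (t₁ + t₂) s₂
  | iteTrue {b P Q s t s'} (hb : b.eval s = true) (h : Exec P s t s') :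
      Exec (Prog.ite b P Q) s (b.cost + t) s'
  | iteFalse {b P Q s t s'} (hb : b.eval s = false) (h : Exec Q s t s') :
      Exec (Prog.ite b P Q) s (b.cost + t) s'
  | loopDone {b P s} (hb : b.eval s = false) : Exec (Prog.loop b P) s b.cost s
  | loopStep {b P s t₁ s₁ t₂ s₂} (hb : b.eval s = true) (h₁ : Exec P s t₁ s₁)
      (h₂ : Exec (Prog.loop b P) s₁ t₂ s₂) : Exec (Prog.loop b P) s (b.cost + t₁ + t₂) s₂

/-- The machine is deterministic: the number of steps and the final memory are determined by the
program and the initial memory. -/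
theorem Exec.unique {P : Prog} {s : Store} {t₁ t₂ : ℕ} {s₁ s₂ : Store}
    (h₁ : Exec P s t₁ s₁) (h₂ : Exec P s t₂ s₂) : t₁ = t₂ ∧ s₁ = s₂ := by
  induction h₁ generalizing t₂ s₂ with
  | skip => cases h₂; exact ⟨rfl, rfl⟩
  | setN => cases h₂; exact ⟨rfl, rfl⟩
  | setR => cases h₂; exact ⟨rfl, rfl⟩
  | storeN => cases h₂; exact ⟨rfl, rfl⟩
  | storeR => cases h₂; exact ⟨rfl, rfl⟩
  | seq _ _ ih₁ ih₂ =>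
    cases h₂ with
    | seq k₁ k₂ =>
      obtain ⟨rfl, rfl⟩ := ih₁ k₁
      obtain ⟨rfl, rfl⟩ := ih₂ k₂
      exact ⟨rfl, rfl⟩
  | iteTrue hb _ ih =>
    cases h₂ with
    | iteTrue _ k =>
      obtain ⟨rfl, rfl⟩ := ih k
      exact ⟨rfl, rfl⟩
    | iteFalse hb' _ => rw [hb] at hb'; cases hb'
  | iteFalse hb _ ih =>
    cases h₂ with
    | iteTrue hb' _ => rw [hb] at hb'; cases hb'
    | iteFalse _ k =>
      obtain ⟨rfl, rfl⟩ := ih k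
      exact ⟨rfl, rfl⟩
  | loopDone hb =>
    cases h₂ with
    | loopDone _ => exact ⟨rfl, rfl⟩
    | loopStep hb' _ _ => rw [hb] at hb'; cases hb'
  | loopStep hb _ _ ih₁ ih₂ =>
    cases h₂ with
    | loopDone hb' => rw [hb] at hb'; cases hb'
    | loopStep _ k₁ k₂ =>
      obtain ⟨rfl, rfl⟩ := ih₁ k₁
      obtain ⟨rfl, rfl⟩ := ih₂ k₂
      exact ⟨rfl, rfl⟩

/-! ## The algorithm -/

namespace Prog

/-- Run the listed programs one after the other. -/
def block : List Prog → Prog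
  | [] => skip
  | [P] => P
  | P :: Q :: l => seq P (block (Q :: l))

/-- `for x = 0, …, e - 1 do P`. -/
def forTo (x : NVar) (e : NExp) (P : Prog) : Prog :=
  block [setN x (NExp.const 0),
    loop (BExp.lt (NExp.var x) e)
      (block [P, setN x (NExp.add (NExp.var x) (NExp.const 1))])]

/-- `if x is not a terminal do P`. -/
def ifNonterminal (x : NVar) (P : Prog) : Prog :=
  ite (BExp.eq (NExp.var x) (NExp.var NVar.zero)) skip
    (ite (BExp.eq (NExp.var x) (NExp.var NVar.one)) skip P)

/-- `A[p] += e` for an index array. -/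
def incN (A : NArr) (p e : NExp) : Prog := storeN A p (NExp.add (NExp.get A p) e)

/-- `A[p] += e` for a real array. -/
def incR (A : RArr) (p : NExp) (e : RExp) : Prog := storeR A p (RExp.add (RExp.get A p) e)

end Prog

open Prog

/-- `label[x]`, the variable index of the node `x`. -/
def labelOf (x : NVar) : NExp := NExp.get NArr.label (NExp.var x)

/-- `x.T`. -/
def childT (x : NVar) : NExp := NExp.get NArr.childT (NExp.var x)

/-- `x.F`. -/
def childF (x : NVar) : NExp := NExp.get NArr.childF (NExp.var x)

/-- `(1 - a[label[x]]) / 2`. -/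
def probT (x : NVar) : RExp :=
  RExp.div (RExp.sub (RExp.const 1) (RExp.get RArr.a (labelOf x))) (RExp.const 2)

/-- `(1 + a[label[x]]) / 2`. -/
def probF (x : NVar) : RExp :=
  RExp.div (RExp.add (RExp.const 1) (RExp.get RArr.a (labelOf x))) (RExp.const 2)

/-- Append the node `p` to the list. -/
def append (p : NExp) : Prog :=
  block [storeN NArr.list (NExp.var NVar.len) p,
    setN NVar.len (NExp.add (NExp.var NVar.len) (NExp.const 1))]

/-- Delete one incoming edge of the node `p`, and append `p` to the list if it was the last one. -/
def deleteEdge (p : NExp) : Prog :=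
  block [storeN NArr.inDeg p (NExp.sub (NExp.get NArr.inDeg p) (NExp.const 1)),
    ite (BExp.eq (NExp.get NArr.inDeg p) (NExp.const 0)) (append p) skip]

/-- Topological sort (Kahn's algorithm). The result is `list[0], …, list[len - 1]`, parents before
children. -/
def topoSort : Prog :=
  block [
    forTo NVar.v (NExp.var NVar.numNodes) (storeN NArr.inDeg (NExp.var NVar.v) (NExp.const 0)),
    forTo NVar.v (NExp.var NVar.numNodes) (ifNonterminal NVar.v (block [
      incN NArr.inDeg (childT NVar.v) (NExp.const 1),
      incN NArr.inDeg (childF NVar.v) (NExp.const 1)])),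
    setN NVar.len (NExp.const 0),
    forTo NVar.v (NExp.var NVar.numNodes)
      (ite (BExp.eq (NExp.get NArr.inDeg (NExp.var NVar.v)) (NExp.const 0))
        (append (NExp.var NVar.v)) skip),
    forTo NVar.head (NExp.var NVar.len) (block [
      setN NVar.v (NExp.get NArr.list (NExp.var NVar.head)),
      ifNonterminal NVar.v (block [deleteEdge (childT NVar.v), deleteEdge (childF NVar.v)])])]

/-- Objective evaluation, top-down. -/
def evalTopDown : Prog :=
  block [
    forTo NVar.v (NExp.var NVar.numNodes) (storeR RArr.mTD (NExp.var NVar.v) (RExp.const 0)),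
    forTo NVar.j (NExp.var NVar.numConstr)
      (storeR RArr.mTD (NExp.get NArr.entry (NExp.var NVar.j))
        (RExp.get RArr.w (NExp.var NVar.j))),
    topoSort,
    forTo NVar.k (NExp.var NVar.len) (block [
      setN NVar.v (NExp.get NArr.list (NExp.var NVar.k)),
      ifNonterminal NVar.v (block [
        incR RArr.mTD (childT NVar.v)
          (RExp.mul (probT NVar.v) (RExp.get RArr.mTD (NExp.var NVar.v))),
        incR RArr.mTD (childF NVar.v)
          (RExp.mul (probF NVar.v) (RExp.get RArr.mTD (NExp.var NVar.v)))])]),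
    setR RVar.valTD (RExp.get RArr.mTD (NExp.var NVar.one))]

/-- For every node `v`, build the linked list `headT[v], nextT[headT[v]], …` of the nodes `u` with
`u.T = v`, and likewise for `F`; the end of a list is marked by the number of nodes. -/
def buildParents : Prog :=
  block [
    forTo NVar.v (NExp.var NVar.numNodes) (block [
      storeN NArr.headT (NExp.var NVar.v) (NExp.var NVar.numNodes),
      storeN NArr.headF (NExp.var NVar.v) (NExp.var NVar.numNodes)]),
    forTo NVar.u (NExp.var NVar.numNodes) (ifNonterminal NVar.u (block [
      storeN NArr.nextT (NExp.var NVar.u) (NExp.get NArr.headT (childT NVar.u)),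
      storeN NArr.headT (childT NVar.u) (NExp.var NVar.u),
      storeN NArr.nextF (NExp.var NVar.u) (NExp.get NArr.headF (childF NVar.u)),
      storeN NArr.headF (childF NVar.u) (NExp.var NVar.u)]))]

/-- For each node `u` in the linked list of the parents of `v`, do `P`. -/
def forParents (hd nxt : NArr) (P : Prog) : Prog :=
  block [
    setN NVar.u (NExp.get hd (NExp.var NVar.v)),
    loop (BExp.lt (NExp.var NVar.u) (NExp.var NVar.numNodes)) (block [
      P,
      setN NVar.u (NExp.get nxt (NExp.var NVar.u))])]

/-- Objective evaluation, bottom-up: the nodes are visited children before parents, that is, in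
the reverse of the order that `topoSort` returns. -/
def evalBottomUp : Prog :=
  block [
    forTo NVar.v (NExp.var NVar.numNodes) (storeR RArr.mBU (NExp.var NVar.v) (RExp.const 0)),
    storeR RArr.mBU (NExp.var NVar.one) (RExp.const 1),
    topoSort,
    buildParents,
    setN NVar.k (NExp.var NVar.len),
    loop (BExp.lt (NExp.const 0) (NExp.var NVar.k)) (block [
      setN NVar.k (NExp.sub (NExp.var NVar.k) (NExp.const 1)),
      setN NVar.v (NExp.get NArr.list (NExp.var NVar.k)),
      forParents NArr.headT NArr.nextT
        (incR RArr.mBU (NExp.var NVar.u)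
          (RExp.mul (probT NVar.u) (RExp.get RArr.mBU (NExp.var NVar.v)))),
      forParents NArr.headF NArr.nextF
        (incR RArr.mBU (NExp.var NVar.u)
          (RExp.mul (probF NVar.u) (RExp.get RArr.mBU (NExp.var NVar.v))))]),
    setR RVar.valBU (RExp.const 0),
    forTo NVar.j (NExp.var NVar.numConstr)
      (setR RVar.valBU (RExp.add (RExp.var RVar.valBU)
        (RExp.mul (RExp.get RArr.mBU (NExp.get NArr.entry (NExp.var NVar.j)))
          (RExp.get RArr.w (NExp.var NVar.j)))))]

/-- Efficient gradient computation. The factor `1 / 2` in the update of `g` is the derivative of the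
edge probabilities `(1 ± a i) / 2`. -/
def gradProgram : Prog :=
  block [
    forTo NVar.i (NExp.var NVar.numVars) (storeR RArr.g (NExp.var NVar.i) (RExp.const 0)),
    evalTopDown,
    evalBottomUp,
    forTo NVar.v (NExp.var NVar.numNodes) (ifNonterminal NVar.v
      (incR RArr.g (labelOf NVar.v)
        (RExp.div
          (RExp.mul (RExp.get RArr.mTD (NExp.var NVar.v))
            (RExp.sub (RExp.get RArr.mBU (childF NVar.v)) (RExp.get RArr.mBU (childT NVar.v))))
          (RExp.const 2))))]

/-- The memory `s` holds the input `(B, a, w)`. Nothing is required of the rest of the memory. -/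
structure Store.Holds {n m N : ℕ} (s : Store) (B : MRBDD n m N) (a : EuclideanSpace ℝ (Fin n))
    (w : Fin m → ℝ) : Prop where
  numVars : s.nat NVar.numVars = n
  numNodes : s.nat NVar.numNodes = N
  numConstr : s.nat NVar.numConstr = m
  zero : s.nat NVar.zero = (B.zero : ℕ)
  one : s.nat NVar.one = (B.one : ℕ)
  entry : ∀ j : Fin m, s.natArr NArr.entry j = (B.entry j : ℕ)
  label : ∀ v i t f, B.cell v = Cell.branch i t f → s.natArr NArr.label v = (i : ℕ)
  childT : ∀ v i t f, B.cell v = Cell.branch i t f → s.natArr NArr.childT v = (t : ℕ)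
  childF : ∀ v i t f, B.cell v = Cell.branch i t f → s.natArr NArr.childF v = (f : ℕ)
  point : ∀ i : Fin n, s.realArr RArr.a i = a i
  weight : ∀ j : Fin m, s.realArr RArr.w j = w j

/-- The first `d` entries of the real array `A`. -/
def Store.vec (s : Store) (A : RArr) (d : ℕ) : Fin d → ℝ := fun i => s.realArr A i

end GradBDD

open GradBDD

/-! Why the output is the gradient. Expanding `∏ i, (1 + x i * sgn (y i))` over subsets shows that
the Walsh-Fourier expansion of `f` at `x` is `∑ y, f y * ∏ i, (1 + x i * sgn (y i)) / 2`, an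
expectation under a product measure when `x` lies in the cube (`wfe_eq_sum`). Let `expect v` be this
quantity for the function rooted at `v`. In an ordered diagram the children of a node labelled `i`
do not depend on variable `i`, so conditioning on that variable yields the bottom-up recursion
(`expect_branch`). The recursion has only one solution, so the bottom-up messages are the values of
`expect`.

Differentiating the recursion in a direction `e` gives `D = W D + r`, where `W` is the matrix of
edge weights and `r v = e i / 2 * (MBU[v.F] - MBU[v.T])` at a node labelled `i`. The top-down
messages solve the adjoint system `M = b + Wᵀ M`, where `b` carries the weights of the entries.
Hence `⟨b, D⟩ = ⟨M, D - W D⟩ = ⟨M, r⟩`. The left side is the directional derivative of the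
objective, the right side is `e` paired with the output (`hasGradientAt_objective`).

Why the program computes the messages in linear time. `Runs` combines halting, a step bound and a
postcondition; loops are handled by invariants that carry the remaining budget. Kahn's algorithm
lists all nodes because edges strictly decrease `rank`, so the diagram is acyclic (`topoSort_runs`).
Along the sorted list each message is final before it is passed on (`topDown_step`,
`BottomUpFrom.step`). A node has at most one child of each kind, so all parent lists together have
at most `2 * N` cells (`sum_degree_le`). Distinct constraints have distinct entries, so `m ≤ N`; if
every variable labels a node, then `n ≤ N`. -/

namespace GradBDD

/-! ## Straight-line code, frames and loop rules -/

namespace Prog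

/-- The program may assign the index variable `x`. -/
def writesVar : Prog → NVar → Bool
  | setN y _, x => decide (x = y)
  | seq P Q, x => P.writesVar x || Q.writesVar x
  | ite _ P Q, x => P.writesVar x || Q.writesVar x
  | loop _ P, x => P.writesVar x
  | _, _ => false

/-- The program may write to the index array `A`. -/
def writesNArr : Prog → NArr → Bool
  | storeN A' _ _, A => decide (A = A')
  | seq P Q, A => P.writesNArr A || Q.writesNArr A
  | ite _ P Q, A => P.writesNArr A || Q.writesNArr A
  | loop _ P, A => P.writesNArr A
  | _, _ => false

/-- The program may write to the real array `A`. -/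
def writesRArr : Prog → RArr → Bool
  | storeR A' _ _, A => decide (A = A')
  | seq P Q, A => P.writesRArr A || Q.writesRArr A
  | ite _ P Q, A => P.writesRArr A || Q.writesRArr A
  | loop _ P, A => P.writesRArr A
  | _, _ => false

/-- The program contains no loop. -/
def loopFree : Prog → Bool
  | seq P Q => P.loopFree && Q.loopFree
  | ite _ P Q => P.loopFree && Q.loopFree
  | loop _ _ => false
  | _ => true

/-- The effect of a program without loops. -/
noncomputable def run : Prog → Store → Store
  | skip, s => s
  | setN x e, s => s.setN x (e.eval s)
  | setR x e, s => s.setR x (e.eval s)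
  | storeN A p e, s => s.storeN A (p.eval s) (e.eval s)
  | storeR A p e, s => s.storeR A (p.eval s) (e.eval s)
  | seq P Q, s => Q.run (P.run s)
  | ite b P Q, s => if b.eval s = true then P.run s else Q.run s
  -- A junk value: executions are derived from `run` only for loop-free programs.
  | loop _ _, s => s

/-- An upper bound for the number of steps of a program without loops. -/
def bound : Prog → ℕ
  | skip => 1
  | setN _ e => e.cost + 1
  | setR _ e => e.cost + 1
  | storeN _ p e => p.cost + e.cost + 1
  | storeR _ p e => p.cost + e.cost + 1
  | seq P Q => P.bound + Q.bound
  | ite b P Q => b.cost + max P.bound Q.bound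
  | loop b _ => b.cost

/-- Loop bodies can thus be evaluated symbolically through `run`, with a cost bound that depends on
the syntax alone. -/
theorem exec_run {P : Prog} (h : P.loopFree = true) (s : Store) :
    ∃ t, Exec P s t (P.run s) ∧ t ≤ P.bound := by
  induction P generalizing s with
  | skip => exact ⟨_, .skip s, le_rfl⟩
  | setN x e => exact ⟨_, .setN s x e, le_rfl⟩
  | setR x e => exact ⟨_, .setR s x e, le_rfl⟩
  | storeN A p e => exact ⟨_, .storeN s A p e, le_rfl⟩
  | storeR A p e => exact ⟨_, .storeR s A p e, le_rfl⟩
  | seq P Q ihP ihQ =>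
    simp only [loopFree, Bool.and_eq_true] at h
    obtain ⟨t₁, h₁, b₁⟩ := ihP h.1 s
    obtain ⟨t₂, h₂, b₂⟩ := ihQ h.2 (P.run s)
    exact ⟨_, .seq h₁ h₂, Nat.add_le_add b₁ b₂⟩
  | ite b P Q ihP ihQ =>
    simp only [loopFree, Bool.and_eq_true] at h
    by_cases hb : b.eval s = true
    · obtain ⟨t, h₁, b₁⟩ := ihP h.1 s
      refine ⟨b.cost + t, ?_, by simp only [bound]; omega⟩
      simp only [run, if_pos hb]
      exact .iteTrue hb h₁
    · obtain ⟨t, h₁, b₁⟩ := ihQ h.2 s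
      refine ⟨b.cost + t, ?_, by simp only [bound]; omega⟩
      simp only [run, if_neg hb]
      exact .iteFalse (by simpa using hb) h₁
  | loop b P => simp [loopFree] at h

end Prog

/-- The memories `s` and `s'` agree in everything that `P` does not write. -/
structure Frame (P : Prog) (s s' : Store) : Prop where
  nat : ∀ x, P.writesVar x = false → s'.nat x = s.nat x
  natArr : ∀ A, P.writesNArr A = false → s'.natArr A = s.natArr A
  realArr : ∀ A, P.writesRArr A = false → s'.realArr A = s.realArr A

namespace Frame

theorem refl (P : Prog) (s : Store) : Frame P s s :=
  ⟨fun _ _ => rfl, fun _ _ => rfl, fun _ _ => rfl⟩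

theorem trans {P : Prog} {s s' s'' : Store} (h : Frame P s s') (h' : Frame P s' s'') :
    Frame P s s'' :=
  ⟨fun x hx => (h'.nat x hx).trans (h.nat x hx),
    fun A hA => (h'.natArr A hA).trans (h.natArr A hA),
    fun A hA => (h'.realArr A hA).trans (h.realArr A hA)⟩

theorem mono {P Q : Prog} {s s' : Store} (h : Frame P s s')
    (hv : ∀ x, Q.writesVar x = false → P.writesVar x = false)
    (hn : ∀ A, Q.writesNArr A = false → P.writesNArr A = false)
    (hr : ∀ A, Q.writesRArr A = false → P.writesRArr A = false) : Frame Q s s' :=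
  ⟨fun x hx => h.nat x (hv x hx), fun A hA => h.natArr A (hn A hA),
    fun A hA => h.realArr A (hr A hA)⟩

theorem seq_left {P Q : Prog} {s s' : Store} (h : Frame P s s') : Frame (.seq P Q) s s' :=
  h.mono (fun _ hx => (Bool.or_eq_false_iff.1 hx).1) (fun _ hx => (Bool.or_eq_false_iff.1 hx).1)
    (fun _ hx => (Bool.or_eq_false_iff.1 hx).1)

theorem seq_right {P Q : Prog} {s s' : Store} (h : Frame Q s s') : Frame (.seq P Q) s s' :=
  h.mono (fun _ hx => (Bool.or_eq_false_iff.1 hx).2) (fun _ hx => (Bool.or_eq_false_iff.1 hx).2)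
    (fun _ hx => (Bool.or_eq_false_iff.1 hx).2)

theorem iteLeft {b : BExp} {P Q : Prog} {s s' : Store} (h : Frame P s s') :
    Frame (.ite b P Q) s s' :=
  h.mono (fun _ hx => (Bool.or_eq_false_iff.1 hx).1) (fun _ hx => (Bool.or_eq_false_iff.1 hx).1)
    (fun _ hx => (Bool.or_eq_false_iff.1 hx).1)

theorem iteRight {b : BExp} {P Q : Prog} {s s' : Store} (h : Frame Q s s') :
    Frame (.ite b P Q) s s' :=
  h.mono (fun _ hx => (Bool.or_eq_false_iff.1 hx).2) (fun _ hx => (Bool.or_eq_false_iff.1 hx).2)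
    (fun _ hx => (Bool.or_eq_false_iff.1 hx).2)

theorem toLoop {b : BExp} {P : Prog} {s s' : Store} (h : Frame P s s') :
    Frame (.loop b P) s s' := h.mono (fun _ hx => hx) (fun _ hx => hx) (fun _ hx => hx)

end Frame

/-- The write sets are computed from the syntax, so preservation of a concrete variable or array by
a concrete program is usually closed by `rfl`. -/
theorem Exec.frame {P : Prog} {s s' : Store} {t : ℕ} (h : Exec P s t s') : Frame P s s' := by
  induction h with
  | skip s => exact .refl _ _
  | setN s x e =>
    refine ⟨fun y hy => ?_, fun _ _ => rfl, fun _ _ => rfl⟩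
    exact Function.update_of_ne (of_decide_eq_false hy) _ _
  | setR s x e => exact ⟨fun _ _ => rfl, fun _ _ => rfl, fun _ _ => rfl⟩
  | storeN s A p e =>
    refine ⟨fun _ _ => rfl, fun y hy => ?_, fun _ _ => rfl⟩
    exact Function.update_of_ne (of_decide_eq_false hy) _ _
  | storeR s A p e =>
    refine ⟨fun _ _ => rfl, fun _ _ => rfl, fun y hy => ?_⟩
    exact Function.update_of_ne (of_decide_eq_false hy) _ _
  | seq _ _ ih₁ ih₂ => exact ih₁.seq_left.trans ih₂.seq_right
  | iteTrue _ _ ih => exact ih.iteLeft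
  | iteFalse _ _ ih => exact ih.iteRight
  | loopDone _ => exact .refl _ _
  | loopStep _ _ _ ih₁ ih₂ => exact ih₁.toLoop.trans ih₂

/-- `P`, started with memory `s`, halts after at most `T` steps with a memory that satisfies
`Q`. -/
def Runs (P : Prog) (s : Store) (T : ℕ) (Q : Store → Prop) : Prop :=
  ∃ t s', Exec P s t s' ∧ t ≤ T ∧ Q s'

namespace Runs

variable {P P' : Prog} {s : Store} {T T' : ℕ} {Q Q' : Store → Prop}

/-- The frame supplied to `hQ` lets postconditions mention only what `P` changes. -/
theorem mono (h : Runs P s T Q) (hT : T ≤ T') (hQ : ∀ s', Frame P s s' → Q s' → Q' s') :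
    Runs P s T' Q' := by
  obtain ⟨t, s', he, ht, hq⟩ := h
  exact ⟨t, s', he, ht.trans hT, hQ s' he.frame hq⟩

theorem seq (h : Runs P s T Q) (h' : ∀ s', Frame P s s' → Q s' → Runs P' s' T' Q') :
    Runs (.seq P P') s (T + T') Q' := by
  obtain ⟨t, s', he, ht, hq⟩ := h
  obtain ⟨t', s'', he', ht', hq'⟩ := h' s' he.frame hq
  exact ⟨t + t', s'', .seq he he', Nat.add_le_add ht ht', hq'⟩

theorem of_run (hP : P.loopFree = true) (h : Q (P.run s)) : Runs P s P.bound Q := by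
  obtain ⟨t, he, ht⟩ := Prog.exec_run hP s
  exact ⟨t, _, he, ht, h⟩

/-- The rule for loops: the invariant `I T` allows for at most `T` further steps. -/
theorem loop {b : BExp} (I : ℕ → Store → Prop) {s₀ : Store}
    (h : ∀ T s, Frame P s₀ s → I T s → (b.eval s = false → b.cost ≤ T ∧ Q s) ∧
      (b.eval s = true → ∃ T₁ T₂, b.cost + T₁ + T₂ ≤ T ∧ Runs P s T₁ (I T₂)))
    (hI : I T s₀) : Runs (.loop b P) s₀ T Q := by
  -- Every test takes a step, so the budget strictly decreases with each iteration and serves as the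
  -- termination measure.
  have hc : 1 ≤ b.cost := by cases b <;> simp [BExp.cost]
  suffices ∀ T s, Frame P s₀ s → I T s → Runs (.loop b P) s T Q from this T s₀ (.refl _ _) hI
  intro T
  induction T using Nat.strong_induction_on with
  | _ T ih =>
    intro s hf hs
    obtain ⟨h₀, h₁⟩ := h T s hf hs
    cases hb : b.eval s with
    | false => exact ⟨_, s, .loopDone hb, (h₀ hb).1, (h₀ hb).2⟩
    | true =>
      obtain ⟨T₁, T₂, hT, t, s', he, ht, hI'⟩ := h₁ hb
      obtain ⟨t', s'', he', ht', hq⟩ := ih T₂ (by omega) s' (hf.trans he.frame) hI'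
      exact ⟨_, s'', .loopStep hb he he', by omega, hq⟩

/-- The rule for counting loops with a bound that may depend on the memory. -/
theorem forTo {x : NVar} {e : NExp} {s₀ : Store} (K c : ℕ) (I : ℕ → Store → Prop)
    (hc : P.bound + e.cost + 6 ≤ c) (hP : P.loopFree = true) (hx : P.writesVar x = false)
    (h₀ : I 0 (s₀.setN x 0))
    (hK : ∀ k s, Frame (Prog.forTo x e P) s₀ s → I k s → k < e.eval s → k < K)
    (hI : ∀ k s, Frame (Prog.forTo x e P) s₀ s → s.nat x = k → I k s → k < e.eval s →
      I (k + 1) ((P.run s).setN x (k + 1))) :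
    Runs (Prog.forTo x e P) s₀ (K * c + c)
      (fun s => ∃ k, k ≤ K ∧ I k s ∧ ¬ k < e.eval s) := by
  have hset : Frame (Prog.forTo x e P) s₀ (s₀.setN x 0) :=
    Frame.seq_left (Exec.frame (.setN s₀ x (.const 0)))
  have key : Runs (.loop (BExp.lt (NExp.var x) e)
      (Prog.block [P, .setN x (NExp.add (NExp.var x) (NExp.const 1))])) (s₀.setN x 0)
      (K * (P.bound + e.cost + 6) + (e.cost + 2))
      (fun s => ∃ k, k ≤ K ∧ I k s ∧ ¬ k < e.eval s) := by
    -- An iteration takes `e.cost + 2` steps for the test, at most `P.bound` for the body and 4 for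
    -- the increment; the last, failing test takes `e.cost + 2` more.
    refine Runs.loop (fun T s => ∃ k, k ≤ K ∧ s.nat x = k ∧ I k s ∧
      T = (K - k) * (P.bound + e.cost + 6) + (e.cost + 2)) ?_
      ⟨0, by omega, by simp [Store.setN], h₀, by simp⟩
    rintro T s hf ⟨k, hk, hxk, hIk, rfl⟩
    have hf' : Frame (Prog.forTo x e P) s₀ s := hset.trans (Frame.seq_right hf.toLoop)
    constructor
    · intro hb
      simp only [BExp.eval, NExp.eval, decide_eq_false_iff_not, hxk] at hb
      refine ⟨?_, k, hk, hIk, hb⟩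
      simp only [BExp.cost, NExp.cost]
      omega
    · intro hb
      simp only [BExp.eval, NExp.eval, decide_eq_true_eq, hxk] at hb
      have hkK := hK k s hf' hIk hb
      refine ⟨P.bound + 4, (K - (k + 1)) * (P.bound + e.cost + 6) + (e.cost + 2), ?_, ?_⟩
      · obtain ⟨d, rfl⟩ : ∃ d, K = k + 1 + d := ⟨K - (k + 1), by omega⟩
        rw [show k + 1 + d - (k + 1) = d by omega, show k + 1 + d - k = d + 1 by omega]
        simp only [BExp.cost, NExp.cost, add_mul]
        omega
      · have hx' : (P.run s).nat x = k := by
          obtain ⟨t, he, -⟩ := Prog.exec_run hP s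
          rw [he.frame.nat x hx, hxk]
        have : Runs (Prog.block [P, .setN x (NExp.add (NExp.var x) (NExp.const 1))]) s
            (Prog.bound (Prog.block [P, .setN x (NExp.add (NExp.var x) (NExp.const 1))]))
            (fun s' => s' = (P.run s).setN x (k + 1)) := by
          refine of_run (by simp [Prog.block, Prog.loopFree, hP]) ?_
          simp [Prog.block, Prog.run, NExp.eval, hx']
        refine this.mono le_rfl ?_
        rintro s' - rfl
        exact ⟨k + 1, hkK, by simp [Store.setN], hI k s hf' hxk hIk hb, rfl⟩
  have := (of_run (P := .setN x (.const 0)) (s := s₀) (Q := fun s => s = s₀.setN x 0) rfl rfl).seq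
    (P' := .loop (BExp.lt (NExp.var x) e)
      (Prog.block [P, .setN x (NExp.add (NExp.var x) (NExp.const 1))])) (fun s' _ hs => hs ▸ key)
  refine this.mono ?_ fun _ _ h => h
  have := Nat.mul_le_mul_left K hc
  simp only [Prog.bound, NExp.cost]
  omega

/-- The rule for counting loops with a fixed bound. -/
theorem forTo_const {x : NVar} {e : NExp} {s₀ : Store} (K c : ℕ) (I : ℕ → Store → Prop)
    (hc : P.bound + e.cost + 6 ≤ c) (hP : P.loopFree = true) (hx : P.writesVar x = false)
    (he : ∀ s, Frame (Prog.forTo x e P) s₀ s → e.eval s = K) (h₀ : I 0 (s₀.setN x 0))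
    (hI : ∀ k s, Frame (Prog.forTo x e P) s₀ s → s.nat x = k → I k s → k < K →
      I (k + 1) ((P.run s).setN x (k + 1))) :
    Runs (Prog.forTo x e P) s₀ (K * c + c) (I K) := by
  refine (forTo K c I hc hP hx h₀ (fun k s hf _ h => he s hf ▸ h)
    (fun k s hf hk hIk h => hI k s hf hk hIk (he s hf ▸ h))).mono le_rfl ?_
  rintro s' hf ⟨k, hk, hIk, hke⟩
  rw [he s' hf] at hke
  obtain rfl : k = K := by omega
  exact hIk

end Runs

/-! ## Reading the memory after an update -/

namespace Store

variable (s : Store)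

@[simp] theorem setN_nat (x y : NVar) (c : ℕ) :
    (s.setN x c).nat y = if y = x then c else s.nat y := Function.update_apply ..

@[simp] theorem setN_natArr (x : NVar) (c : ℕ) : (s.setN x c).natArr = s.natArr := rfl

@[simp] theorem setN_realArr (x : NVar) (c : ℕ) : (s.setN x c).realArr = s.realArr := rfl

@[simp] theorem storeN_nat (A : NArr) (p c : ℕ) : (s.storeN A p c).nat = s.nat := rfl

@[simp] theorem storeN_natArr (A A' : NArr) (p c : ℕ) :
    (s.storeN A p c).natArr A' =
      if A' = A then Function.update (s.natArr A) p c else s.natArr A' :=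
  Function.update_apply ..

@[simp] theorem storeR_nat (A : RArr) (p : ℕ) (r : ℝ) : (s.storeR A p r).nat = s.nat := rfl

@[simp] theorem storeR_natArr (A : RArr) (p : ℕ) (r : ℝ) :
    (s.storeR A p r).natArr = s.natArr := rfl

@[simp] theorem storeR_realArr (A A' : RArr) (p : ℕ) (r : ℝ) :
    (s.storeR A p r).realArr A' =
      if A' = A then Function.update (s.realArr A) p r else s.realArr A' :=
  Function.update_apply ..

/-- The input is preserved by programs that write to none of its variables and arrays. -/
theorem Holds.frame {n m N : ℕ} {B : MRBDD n m N} {a : EuclideanSpace ℝ (Fin n)} {w : Fin m → ℝ}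
    {P : Prog} {s s' : Store} (h : s.Holds B a w) (hf : Frame P s s')
    (hv : ([NVar.numVars, .numNodes, .numConstr, .zero, .one].any P.writesVar) = false)
    (hn : ([NArr.label, .childT, .childF, .entry].any P.writesNArr) = false)
    (hr : ([RArr.a, .w].any P.writesRArr) = false) : s'.Holds B a w := by
  simp only [List.any_cons, List.any_nil, Bool.or_eq_false_iff] at hv hn hr
  obtain ⟨v1, v2, v3, v4, v5, -⟩ := hv
  obtain ⟨n1, n2, n3, n4, -⟩ := hn
  obtain ⟨r1, r2, -⟩ := hr
  constructor
  · rw [hf.nat _ v1]; exact h.numVars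
  · rw [hf.nat _ v2]; exact h.numNodes
  · rw [hf.nat _ v3]; exact h.numConstr
  · rw [hf.nat _ v4]; exact h.zero
  · rw [hf.nat _ v5]; exact h.one
  · rw [hf.natArr _ n4]; exact h.entry
  · rw [hf.natArr _ n1]; exact h.label
  · rw [hf.natArr _ n2]; exact h.childT
  · rw [hf.natArr _ n3]; exact h.childF
  · rw [hf.realArr _ r1]; exact h.point
  · rw [hf.realArr _ r2]; exact h.weight

end Store

open Prog

/-! ## Edges -/

namespace MRBDD

variable {n m N : ℕ} (B : MRBDD n m N)

/-- The `True` child (`b = true`) or the `False` child of a decision node. -/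
def child (b : Bool) (v : Fin N) : Option (Fin N) :=
  match B.cell v with
  | Cell.branch _ t f => some (if b then t else f)
  | _ => none

/-- The number of edges from `u` to `v`. -/
def mult (u v : Fin N) : ℕ :=
  match B.cell u with
  | Cell.branch _ t f => (if t = v then 1 else 0) + (if f = v then 1 else 0)
  | _ => 0

theorem mult_branch {u v t f : Fin N} {i : Fin n} (h : B.cell u = Cell.branch i t f) :
    B.mult u v = (if t = v then 1 else 0) + (if f = v then 1 else 0) := by
  simp only [mult, h]

theorem mult_ne_zero_iff {u v : Fin N} : B.mult u v ≠ 0 ↔ ∃ b, B.child b u = some v := by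
  cases h : B.cell u with
  | zero => simp [mult, child, h]
  | one => simp [mult, child, h]
  | branch i t f =>
    by_cases ht : t = v <;> by_cases hf : f = v <;> simp [mult, child, h, ht, hf]

/-- The certificate of acyclicity: it excludes self-loops and later forces Kahn's algorithm to reach
every node. -/
theorem rank_lt_of_mult {u v : Fin N} (h : B.mult u v ≠ 0) : B.rank v < B.rank u := by
  cases hc : B.cell u with
  | zero => simp [mult, hc] at h
  | one => simp [mult, hc] at h
  | branch i t f =>
    refine B.rank_child hc ?_
    by_contra hv
    push Not at hv
    exact h (by simp [mult, hc, hv.1.symm, hv.2.symm])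

theorem mult_self (v : Fin N) : B.mult v v = 0 := by
  by_contra h
  exact lt_irrefl _ (B.rank_lt_of_mult h)

end MRBDD

section

variable {n m N : ℕ} {B : MRBDD n m N} {a : EuclideanSpace ℝ (Fin n)} {w : Fin m → ℝ} {s : Store}

/-- The machine only compares addresses with the two terminals. Since each kind of terminal occurs
at exactly one node, this decides the kind of the cell. -/
theorem run_ifNonterminal (h : s.Holds B a w) {x : NVar} {v : Fin N} (hx : s.nat x = v)
    (P : Prog) : (ifNonterminal x P).run s =
      match B.cell v with
      | Cell.branch _ _ _ => P.run s
      | _ => s := by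
  have h0 := B.cell_zero_iff v
  have h1 := B.cell_one_iff v
  change (if decide (s.nat x = s.nat NVar.zero) = true then s
    else if decide (s.nat x = s.nat NVar.one) = true then s else P.run s) = _
  rw [hx, h.zero, h.one]
  cases hc : B.cell v with
  | zero => rw [if_pos (decide_eq_true (by rw [h0.1 hc]))]
  | one =>
    rw [if_pos (c := decide ((v : ℕ) = B.one) = true) (decide_eq_true (by rw [h1.1 hc])), ite_self]
  | branch i t f =>
    have h0' : (v : ℕ) ≠ B.zero := fun e => by simpa [hc] using h0.2 (Fin.val_injective e)
    have h1' : (v : ℕ) ≠ B.one := fun e => by simpa [hc] using h1.2 (Fin.val_injective e)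
    rw [if_neg (by simpa using h0'), if_neg (by simpa using h1')]

/-! ## Topological sort -/

/-- The list that is stored in the memory consists of the nodes `L`. -/
structure ListRep (s : Store) (L : List (Fin N)) : Prop where
  len : s.nat NVar.len = L.length
  get : ∀ p (hp : p < L.length), s.natArr NArr.list p = (L[p] : ℕ)

theorem ListRep.run_append {L : List (Fin N)} (h : ListRep s L) {p : NExp} {v : Fin N}
    (hp : p.eval s = v) : ListRep ((append p).run s) (L ++ [v]) := by
  constructor
  · simp [GradBDD.append, block, run, NExp.eval, h.len]
  · intro q hq
    simp only [GradBDD.append, block, run, Store.setN_natArr, Store.storeN_natArr, if_true, hp,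
      NExp.eval, h.len, Function.update_apply]
    rw [List.length_append, List.length_singleton] at hq
    split_ifs with hqL
    · subst hqL; simp
    · rw [List.getElem_append_left (by omega), h.get]

/-- The state of Kahn's algorithm: the nodes `L` have been listed, and `d v` incoming edges of `v`
have not been deleted. -/
structure KahnState (B : MRBDD n m N) (s : Store) (L : List (Fin N)) (d : Fin N → ℕ) : Prop where
  rep : ListRep s L
  nodup : L.Nodup
  deg : ∀ v : Fin N, s.natArr NArr.inDeg v = d v
  mem : ∀ v, v ∈ L ↔ d v = 0
  sorted : L.Pairwise fun u v => B.mult v u = 0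

/-- By `hd` the node `v` is not yet listed, so appending it creates no duplicate; by `hL` it creates
no backward edge. The address `p` is evaluated again after the counter has changed, which is why
`hp` ranges over memories that may differ from `s` in `inDeg`. -/
theorem KahnState.run_deleteEdge {L : List (Fin N)} {d : Fin N → ℕ} (h : KahnState B s L d)
    {p : NExp} {v : Fin N} (hp : ∀ s' : Store, s'.nat = s.nat →
      (∀ A, A ≠ NArr.inDeg → s'.natArr A = s.natArr A) → p.eval s' = v)
    (hd : d v ≠ 0) (hL : ∀ u ∈ L, B.mult v u = 0) :
    ∃ L', KahnState B ((deleteEdge p).run s) (L ++ L') (Function.update d v (d v - 1)) := by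
  have hps : p.eval s = v := hp s rfl fun _ _ => rfl
  set s₁ := s.storeN NArr.inDeg v (d v - 1) with hs₁
  have hps₁ : p.eval s₁ = v := hp s₁ rfl fun A hA => by simp [hs₁, hA]
  have hdeg : ∀ u : Fin N, s₁.natArr NArr.inDeg u = Function.update d v (d v - 1) u := by
    intro u
    simp only [hs₁, Store.storeN_natArr, if_true, Function.update_apply, Fin.val_inj, h.deg]
  have hrep : ListRep s₁ L := ⟨h.rep.len, fun q hq => by simpa [hs₁] using h.rep.get q hq⟩
  have hvL : v ∉ L := fun hv => hd ((h.mem v).1 hv)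
  have hrun : (deleteEdge p).run s = if d v - 1 = 0 then (append p).run s₁ else s₁ := by
    simp only [GradBDD.deleteEdge, block, run, NExp.eval, hps, h.deg, ← hs₁, BExp.eval, hps₁, hdeg,
      Function.update_self, decide_eq_true_eq]
  rw [hrun]
  split_ifs with h1
  · refine ⟨[v], hrep.run_append hps₁, ?_, ?_, ?_, ?_⟩
    · simpa [List.nodup_append, h.nodup] using fun u hu (e : u = v) => hvL (e ▸ hu)
    · intro u
      rw [← hdeg]
      simp [GradBDD.append, block, run]
    · intro u
      by_cases hu : u = v
      · simp [hu, h1]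
      · simp [hu, h.mem]
    · rw [List.pairwise_append]
      exact ⟨h.sorted, by simp, by simpa using hL⟩
  · refine ⟨[], by simpa using hrep, by simpa using h.nodup, hdeg, ?_, by simpa using h.sorted⟩
    intro u
    by_cases hu : u = v
    · subst hu; simp [h1, hvL]
    · simp [hu, h.mem]

/-- The memory holds a topologically sorted list of all nodes, in which `v` is at position
`pos v`. -/
structure IsSorted (B : MRBDD n m N) (s : Store) (pos : Fin N → ℕ) : Prop where
  len : s.nat NVar.len = N
  get : ∀ v, s.natArr NArr.list (pos v) = (v : ℕ)
  injective : Function.Injective pos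
  exists_pos : ∀ k < N, ∃ v, pos v = k
  lt : ∀ u v, B.mult u v ≠ 0 → pos u < pos v

/-- The `N` nodes already cover all `N` positions below `N`, so none is left for another position.
-/
theorem IsSorted.pos_lt {pos : Fin N → ℕ} (h : IsSorted B s pos) (v : Fin N) : pos v < N := by
  have hsurj : (Finset.range N) ⊆ Finset.univ.image pos := fun k hk => by
    obtain ⟨v, hv⟩ := h.exists_pos k (Finset.mem_range.1 hk)
    exact Finset.mem_image.2 ⟨v, Finset.mem_univ _, hv⟩
  have heq := Finset.eq_of_subset_of_card_le hsurj (Finset.card_image_le.trans (by simp))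
  have : pos v ∈ Finset.range N := heq ▸ Finset.mem_image_of_mem pos (Finset.mem_univ v)
  exact Finset.mem_range.1 this

theorem IsSorted.of_list {L : List (Fin N)} (hr : ListRep s L) (hn : L.Nodup) (hm : ∀ v, v ∈ L)
    (hs : L.Pairwise fun u v => B.mult v u = 0) : IsSorted B s fun v => L.idxOf v := by
  have hlen : L.length = N := by
    rw [← List.toFinset_card_of_nodup hn,
      (Finset.eq_univ_iff_forall.2 fun v => List.mem_toFinset.2 (hm v) : L.toFinset = _)]
    simp
  refine ⟨hr.len.trans hlen, fun v => ?_, fun u v huv => ?_, fun k hk => ?_, fun u v huv => ?_⟩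
  · rw [hr.get _ (List.idxOf_lt_length_iff.2 (hm v)), List.getElem_idxOf]
  · exact (List.idxOf_inj (hm u)).1 huv
  · exact ⟨L[k]'(by omega), hn.idxOf_getElem k (by omega)⟩
  -- Otherwise `v` is listed before `u`, and sortedness forbids the edge from `u` to `v`, or `u =
  -- v`, and there are no self-loops.
  · by_contra hle
    rcases (not_lt.1 hle).lt_or_eq with hlt | heq
    · have := List.pairwise_iff_getElem.1 hs _ _ (List.idxOf_lt_length_iff.2 (hm v))
        (List.idxOf_lt_length_iff.2 (hm u)) hlt
      rw [List.getElem_idxOf, List.getElem_idxOf] at this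
      exact huv this
    · obtain rfl := (List.idxOf_inj (hm v)).1 heq
      exact huv (B.mult_self _)

/-- Several loop invariants below are partial sums over the nodes already visited; this is their
induction step. -/
theorem filter_lt_succ {g : Fin N → ℕ} (hg : Function.Injective g) (x : Fin N) :
    Finset.univ.filter (fun u => g u < g x + 1) =
      insert x (Finset.univ.filter fun u => g u < g x) := by
  ext u
  simp only [Finset.mem_filter, Finset.mem_univ, true_and, Finset.mem_insert]
  rw [Nat.lt_succ_iff_lt_or_eq, hg.eq_iff, or_comm]

/-- The number of edges into `v` whose source is not in `D`. -/
def MRBDD.inDegree (B : MRBDD n m N) (D : Finset (Fin N)) (v : Fin N) : ℕ :=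
  ∑ u ∈ Dᶜ, B.mult u v

theorem MRBDD.inDegree_insert {D : Finset (Fin N)} {x : Fin N} (hx : x ∉ D) (v : Fin N) :
    B.inDegree D v = B.mult x v + B.inDegree (insert x D) v := by
  rw [inDegree, inDegree, Finset.compl_insert,
    Finset.add_sum_erase _ (fun u => B.mult u v) (Finset.mem_compl.2 hx)]

/-- One iteration of the main loop of Kahn's algorithm. -/
theorem KahnState.step {L : List (Fin N)} {D : Finset (Fin N)} (h : s.Holds B a w)
    (hs : KahnState B s L (B.inDegree D)) {x : Fin N} (hx : s.nat NVar.v = x) (hxL : x ∈ L)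
    (hxD : x ∉ D) (hDL : D ⊆ L.toFinset) :
    ∃ L', KahnState B ((ifNonterminal NVar.v (block [deleteEdge (GradBDD.childT NVar.v),
      deleteEdge (GradBDD.childF NVar.v)])).run s) (L ++ L') (B.inDegree (insert x D)) := by
  have hins := fun v => B.inDegree_insert hxD v
  rw [run_ifNonterminal h hx]
  have hterm : (∀ v, B.mult x v = 0) →
      ∃ L', KahnState B s (L ++ L') (B.inDegree (insert x D)) := fun h0 => by
    have heq : B.inDegree D = B.inDegree (insert x D) := funext fun v => by
      rw [hins, h0, zero_add]
    exact ⟨[], by simpa [heq] using hs⟩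
  cases hc : B.cell x with
  | zero => exact hterm fun v => by simp [MRBDD.mult, hc]
  | one => exact hterm fun v => by simp [MRBDD.mult, hc]
  | branch i t f =>
    have hm := fun v => B.mult_branch (v := v) hc
    -- a listed node has no incoming edge from a node outside of `insert x D`
    have key : ∀ {u v : Fin N} {d : ℕ}, B.inDegree (insert x D) v ≤ d → d = 0 →
        u ∉ insert x D → B.mult u v = 0 := fun {u v d} hle h0 hu =>
      Finset.sum_eq_zero_iff.1 (Nat.le_zero.1 (h0 ▸ hle)) u (Finset.mem_compl.2 hu)
    -- Processed nodes are listed, so `key` applies to the edges that leave an unlisted node: none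
    -- of them ends in a listed node.
    have hsub : ∀ v ∉ L, v ∉ insert x D := fun v hv hvD => by
      rcases Finset.mem_insert.1 hvD with rfl | hvD
      · exact hv hxL
      · exact hv (List.mem_toFinset.1 (hDL hvD))
    have hdt : B.inDegree D t ≠ 0 := by rw [hins, hm]; simp
    obtain ⟨L₁, hs₁⟩ := hs.run_deleteEdge (p := GradBDD.childT NVar.v) (v := t)
      (fun s' hn hA => by
        simp only [GradBDD.childT, NExp.eval, hn, hx, hA NArr.childT (by simp)]
        exact h.childT x i t f hc) hdt
      (fun u hu => key (by rw [hins u]; omega) ((hs.mem u).1 hu)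
        (hsub t fun ht => hdt ((hs.mem t).1 ht)))
    set s₁ := (GradBDD.deleteEdge (GradBDD.childT NVar.v)).run s with hs₁_def
    have hf₁ : Frame (GradBDD.deleteEdge (GradBDD.childT NVar.v)) s s₁ := by
      obtain ⟨_, he, -⟩ := exec_run
        (P := GradBDD.deleteEdge (GradBDD.childT NVar.v)) rfl s
      exact he.frame
    set d₁ := Function.update (B.inDegree D) t (B.inDegree D t - 1) with hd₁
    -- What remains to be deleted is the `False` edge. This includes the case `t = f`, where the
    -- same counter is decremented twice.
    have hd₁v : ∀ v, d₁ v = (if f = v then 1 else 0) + B.inDegree (insert x D) v := fun v => by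
      by_cases hv : v = t
      · subst hv
        rw [hd₁, Function.update_self, hins, hm, if_pos rfl]
        omega
      · rw [hd₁, Function.update_of_ne hv, hins, hm, if_neg (Ne.symm hv)]
        omega
    have hdf : d₁ f ≠ 0 := by rw [hd₁v]; simp
    obtain ⟨L₂, hs₂⟩ := hs₁.run_deleteEdge (p := GradBDD.childF NVar.v) (v := f)
      (fun s' hn hA => by
        simp only [GradBDD.childF, NExp.eval, hn, hf₁.nat NVar.v rfl, hx,
          hA NArr.childF (by simp), hf₁.natArr NArr.childF rfl]
        exact h.childF x i t f hc) hdf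
      (fun u hu => key (by rw [hd₁v u]; omega) ((hs₁.mem u).1 hu)
        (hsub f fun hfL => hdf ((hs₁.mem f).1 (List.mem_append_left _ hfL))))
    refine ⟨L₁ ++ L₂, ?_⟩
    have heq : Function.update d₁ f (d₁ f - 1) = B.inDegree (insert x D) := funext fun v => by
      by_cases hv : v = f
      · subst hv
        rw [Function.update_self, hd₁v, if_pos rfl]
        omega
      · rw [Function.update_of_ne hv, hd₁v, if_neg (Ne.symm hv), zero_add]
    rw [heq, List.append_assoc] at hs₂
    simpa [block, run] using hs₂

/-- The processed nodes form the prefix `L.take k` of the list. The counters count the edges from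
all other nodes, and a node is listed exactly when its counter is zero. -/
theorem topoSort_runs (h : s.Holds B a w) :
    Runs topoSort s (500 * N + 500) fun s' => ∃ pos, IsSorted B s' pos := by
  have hN : ∀ {s' : Store}, s'.Holds B a w → (NExp.var NVar.numNodes).eval s' = N := fun h' =>
    h'.numNodes
  -- the counters are cleared
  have r1 := Runs.forTo_const (x := NVar.v) (e := NExp.var NVar.numNodes)
    (P := storeN NArr.inDeg (NExp.var NVar.v) (NExp.const 0)) (s₀ := s) N 100
    (fun k s => ∀ v : Fin N, v < k → s.natArr NArr.inDeg v = 0) (by decide) rfl rfl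
    (fun s' hf => hN (h.frame hf rfl rfl rfl)) (fun v hv => absurd hv (by omega))
    (fun k s' hf hk hI _ v hv => by
      simp only [run, NExp.eval, Store.setN_natArr, Store.storeN_natArr, if_true, hk,
        Function.update_apply]
      split_ifs with hvk
      · rfl
      · exact hI v (by omega))
  refine (Runs.seq r1 fun s₁ hf₁ hs₁ => ?_).mono
    -- Four loops of at most `N` iterations, with 100 a generous bound for each iteration, and one
    -- assignment.
    (T := (N * 100 + 100) + ((N * 100 + 100) + (2 + ((N * 100 + 100) + (N * 100 + 100)))))
    (by omega) fun _ _ h => h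
  · -- the edges are counted
    have h₁ : s₁.Holds B a w := h.frame hf₁ rfl rfl rfl
    refine Runs.seq (Runs.forTo_const (s₀ := s₁) N 100
      (fun k s => ∀ v : Fin N, s.natArr NArr.inDeg v =
        ∑ u ∈ Finset.univ.filter (fun u : Fin N => (u : ℕ) < k), B.mult u v) (by decide) rfl rfl
      (fun s' hf => hN (h₁.frame hf rfl rfl rfl)) (fun v => by simpa using hs₁ v v.isLt)
      (fun k s' hf hk hI hkN v => ?_)) fun s₂ hf₂ hs₂ => ?_
    · have h' : s'.Holds B a w := h₁.frame hf rfl rfl rfl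
      obtain ⟨x, rfl⟩ : ∃ x : Fin N, (x : ℕ) = k := ⟨⟨k, hkN⟩, rfl⟩
      rw [filter_lt_succ Fin.val_injective, Finset.sum_insert (by simp), run_ifNonterminal h' hk,
        ← hI]
      cases hc : B.cell x with
      | zero => simp [MRBDD.mult, hc]
      | one => simp [MRBDD.mult, hc]
      | branch i t f =>
        have ht := h'.childT x i t f hc
        have hf := h'.childF x i t f hc
        simp only [block, run, incN, childT, childF, NExp.eval, Store.storeN_natArr,
          Store.storeN_nat, if_true, hk, ht, hf, reduceCtorEq, if_false, Function.update_apply,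
          Store.setN_natArr, Fin.val_inj, B.mult_branch hc, eq_comm (a := v)]
        split_ifs <;> simp_all <;> omega
    refine Runs.seq (T := 2) (Q := fun s => s = s₂.setN NVar.len 0) (Runs.of_run rfl rfl)
      fun s₃ hf₃ hs₃ => ?_
    subst hs₃
    set s₃ := s₂.setN NVar.len 0 with hs₃
    have h₂ : s₂.Holds B a w := h₁.frame hf₂ rfl rfl rfl
    have h₃ : s₃.Holds B a w := h₂.frame hf₃ rfl rfl rfl
    have hdeg₃ : ∀ v : Fin N, s₃.natArr NArr.inDeg v = B.inDegree ∅ v := fun v => by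
      rw [hs₃, Store.setN_natArr, hs₂ v, MRBDD.inDegree]
      exact Finset.sum_congr (by ext; simp) fun _ _ => rfl
    -- the roots are listed
    refine Runs.seq (Runs.forTo_const (s₀ := s₃) N 100
      (fun k s => ∃ L : List (Fin N), ListRep s L ∧ L.Nodup ∧
        ∀ v, v ∈ L ↔ (v : ℕ) < k ∧ B.inDegree ∅ v = 0) (by decide) rfl rfl
      (fun s' hf => hN (h₃.frame hf rfl rfl rfl))
      ⟨[], ⟨by simp [hs₃], by simp⟩, List.nodup_nil, by simp⟩ ?_) fun s₄ hf₄ hs₄ => ?_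
    · rintro k s' hf hk ⟨L, hr, hn, hm⟩ hkN
      obtain ⟨x, rfl⟩ : ∃ x : Fin N, (x : ℕ) = k := ⟨⟨k, hkN⟩, rfl⟩
      have hd : s'.natArr NArr.inDeg x = B.inDegree ∅ x := by
        rw [hf.natArr NArr.inDeg rfl, hdeg₃]
      have hxL : x ∉ L := fun hx => by simpa using ((hm x).1 hx).1
      simp only [run, BExp.eval, NExp.eval, hk, hd, decide_eq_true_eq]
      split_ifs with h0
      · obtain ⟨hl, hg⟩ := hr.run_append (p := NExp.var NVar.v) (v := x) hk
        refine ⟨L ++ [x], ⟨by simpa using hl, by simpa using hg⟩, ?_, fun v => ?_⟩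
        · simpa [List.nodup_append, hn] using fun u hu (e : u = x) => hxL (e ▸ hu)
        · rw [List.mem_append, hm, List.mem_singleton]
          constructor
          · rintro (⟨h1, h2⟩ | rfl)
            · exact ⟨by omega, h2⟩
            · exact ⟨by omega, h0⟩
          · rintro ⟨h1, h2⟩
            rcases Nat.lt_succ_iff_lt_or_eq.1 h1 with h1 | h1
            · exact .inl ⟨h1, h2⟩
            · exact .inr (Fin.val_injective h1)
      · refine ⟨L, ⟨by simpa using hr.len, by simpa using hr.get⟩, hn, fun v => ?_⟩
        rw [hm]
        constructor
        · rintro ⟨h1, h2⟩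
          exact ⟨by omega, h2⟩
        · rintro ⟨h1, h2⟩
          rcases Nat.lt_succ_iff_lt_or_eq.1 h1 with h1 | h1
          · exact ⟨h1, h2⟩
          · exact absurd (Fin.val_injective h1 ▸ h2) h0
    have h₄ : s₄.Holds B a w := h₃.frame hf₄ rfl rfl rfl
    -- the listed nodes are removed
    refine Runs.mono (Runs.forTo (s₀ := s₄) N 100
      (fun k s => ∃ L : List (Fin N), k ≤ L.length ∧
        KahnState B s L (B.inDegree (L.take k).toFinset)) (by decide) rfl rfl ?_ ?_ ?_) le_rfl ?_
    · obtain ⟨L, hr, hn, hm⟩ := hs₄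
      refine ⟨L, Nat.zero_le _, ⟨by simpa using hr.len, by simpa using hr.get⟩, hn, fun v => ?_,
        fun v => ?_, ?_⟩
      · simp only [Store.setN_natArr, hf₄.natArr NArr.inDeg rfl, hdeg₃]
        simp
      · rw [hm]
        simp
      · refine List.pairwise_of_forall_mem_list fun u hu v _ => ?_
        exact Finset.sum_eq_zero_iff.1 ((hm u).1 hu).2 v (by simp)
    -- The list repeats no node, so although it grows during the loop, the head stays below `N`.
    · rintro k s' hf ⟨L, -, hs⟩ hk
      have : L.length ≤ N := by simpa using hs.nodup.length_le_card
      simp only [NExp.eval, hs.rep.len] at hk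
      omega
    · rintro k s' hf hk ⟨L, -, hs⟩ hkL
      simp only [NExp.eval, hs.rep.len] at hkL
      have hget := hs.rep.get k hkL
      set s₅ := s'.setN NVar.v L[k] with hs₅
      have hf₅ : Frame (setN NVar.v (NExp.get NArr.list (NExp.var NVar.head))) s' s₅ := by
        have := (Exec.setN s' NVar.v (NExp.get NArr.list (NExp.var NVar.head))).frame
        simpa [NExp.eval, hk, hget] using this
      have h₅ : s₅.Holds B a w := (h₄.frame hf rfl rfl rfl).frame hf₅ rfl rfl rfl
      have hs' : KahnState B s₅ L (B.inDegree (L.take k).toFinset) :=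
        ⟨⟨by simpa [hs₅] using hs.rep.len, by simpa [hs₅] using hs.rep.get⟩, hs.nodup, hs.deg,
          hs.mem, hs.sorted⟩
      obtain ⟨L', hL'⟩ := hs'.step h₅ (x := L[k]) (by simp [hs₅]) (List.getElem_mem _)
        (by
          rw [List.mem_toFinset]
          intro hmem
          obtain ⟨j, hj, hjk⟩ := List.getElem_of_mem hmem
          rw [List.getElem_take] at hjk
          have := (hs.nodup.getElem_inj_iff).1 hjk
          rw [List.length_take] at hj
          omega)
        (fun v hv => List.mem_toFinset.2 (List.mem_of_mem_take (List.mem_toFinset.1 hv)))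
      refine ⟨L ++ L', by simp; omega, ?_⟩
      have htake : ((L ++ L').take (k + 1)).toFinset = insert L[k] (L.take k).toFinset := by
        rw [List.take_append_of_le_length hkL, List.take_succ_eq_append_getElem hkL]
        ext
        rw [List.mem_toFinset, List.mem_append, Finset.mem_insert, List.mem_toFinset,
          List.mem_singleton, or_comm]
      rw [htake]
      simp only [block, run, NExp.eval, hk, hget, ← hs₅] at hL' ⊢
      exact ⟨⟨by simpa using hL'.rep.len, by simpa using hL'.rep.get⟩, hL'.nodup, hL'.deg,
        hL'.mem, hL'.sorted⟩
    · rintro s' - ⟨k, -, ⟨L, hkL, hs⟩, hk⟩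
      simp only [NExp.eval, hs.rep.len] at hk
      rw [show k = L.length by omega, List.take_length] at hs
      refine ⟨_, IsSorted.of_list hs.rep hs.nodup (fun v => ?_) hs.sorted⟩
      by_contra hv
      -- An unlisted node of maximal rank has a nonzero counter, hence an unlisted parent, whose
      -- rank is larger still.
      obtain ⟨u, hu, hmax⟩ := Finset.exists_max_image (Finset.univ.filter (· ∉ L)) B.rank
        ⟨v, by simpa using hv⟩
      have hu' : u ∉ L := by simpa using hu
      obtain ⟨p, hp, hpu⟩ := Finset.exists_ne_zero_of_sum_ne_zero (mt (hs.mem u).2 hu')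
      have := hmax p (by simpa using hp)
      exact absurd (B.rank_lt_of_mult hpu) (by omega)

end

/-! ### Edge weights and the message equations in terms of them -/

namespace MRBDD

variable {n m N : ℕ} (B : MRBDD n m N) (a : EuclideanSpace ℝ (Fin n))

/-- The total probability of the edges from `u` to `v`. -/
noncomputable def weight (u v : Fin N) : ℝ :=
  match B.cell u with
  | Cell.branch i t f => (if t = v then (1 - a i) / 2 else 0) + (if f = v then (1 + a i) / 2 else 0)
  | _ => 0

/-- The probability of the `True` edge (`b = true`) or the `False` edge of a decision node. -/
noncomputable def prob (b : Bool) (v : Fin N) : ℝ :=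
  match B.cell v with
  | Cell.branch i _ _ => if b then (1 - a i) / 2 else (1 + a i) / 2
  | _ => 0

variable {B a}

theorem weight_branch {u v t f : Fin N} {i : Fin n} (h : B.cell u = Cell.branch i t f) :
    B.weight a u v =
      (if t = v then (1 - a i) / 2 else 0) + (if f = v then (1 + a i) / 2 else 0) := by
  simp only [weight, h]

/-- The converse fails: at `a i = 1` or `a i = -1` an edge can have weight zero. -/
theorem mult_ne_zero_of_weight {u v : Fin N} (h : B.weight a u v ≠ 0) : B.mult u v ≠ 0 := by
  contrapose! h
  cases hc : B.cell u with
  | zero => simp [weight, hc]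
  | one => simp [weight, hc]
  | branch i t f =>
    rw [mult_branch B hc] at h
    rw [weight_branch hc]
    split_ifs at h ⊢ <;> simp_all

/-- The matrix form of the equations, with parallel edges merged; both the loop invariant and the
adjoint argument use it. -/
theorem isTopDown_iff {w : Fin m → ℝ} {M : Fin N → ℝ} : B.IsTopDown a w M ↔
    ∀ v, M v = (∑ j, if B.entry j = v then w j else 0) + ∑ u, B.weight a u v * M u := by
  refine forall_congr' fun v => ?_
  refine Eq.congr_right (congrArg _ (Finset.sum_congr rfl fun u _ => ?_))
  cases hc : B.cell u with
  | zero => simp [weight, hc]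
  | one => simp [weight, hc]
  | branch i t f => simp [weight, hc, add_mul, ite_mul]

/-- This is the shape in which the messages accumulate: the initial value plus one contribution per
outgoing edge. Terminals have no such edges. -/
theorem isBottomUp_of {M : Fin N → ℝ} (h : ∀ v, M v = (if v = B.one then 1 else 0) +
    ∑ b, match B.child b v with
      | some t => B.prob a b v * M t
      | none => 0) : B.IsBottomUp a M := by
  intro v
  cases hc : B.cell v with
  | zero =>
    have hv : v ≠ B.one := fun e => by simpa [hc] using (B.cell_one_iff v).2 e
    rw [h]
    simp [child, hc, hv]
  | one =>
    rw [h, if_pos ((B.cell_one_iff v).1 hc)]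
    simp [child, hc]
  | branch i t f =>
    have hv : v ≠ B.one := fun e => by simpa [hc] using (B.cell_one_iff v).2 e
    rw [h]
    simp [child, prob, hc, hv]

end MRBDD

section

variable {n m N : ℕ} {B : MRBDD n m N} {a : EuclideanSpace ℝ (Fin n)} {w : Fin m → ℝ} {s : Store}

theorem probT_eval (h : s.Holds B a w) {x : NVar} {v : Fin N} (hx : s.nat x = v) {i : Fin n}
    {t f : Fin N} (hc : B.cell v = Cell.branch i t f) : (probT x).eval s = (1 - a i) / 2 := by
  simp only [probT, RExp.eval, labelOf, NExp.eval, hx, h.label v i t f hc, h.point]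
  norm_num

theorem probF_eval (h : s.Holds B a w) {x : NVar} {v : Fin N} (hx : s.nat x = v) {i : Fin n}
    {t f : Fin N} (hc : B.cell v = Cell.branch i t f) : (probF x).eval s = (1 + a i) / 2 := by
  simp only [probF, RExp.eval, labelOf, NExp.eval, hx, h.label v i t f hc, h.point]
  norm_num

/-! ## Top-down messages -/

/-- Edges lead to later positions, so pushing from `x` changes neither the message of `x` nor any
earlier one: the terms already in the sum are final. -/
theorem topDown_step {pos : Fin N → ℕ} (hinj : Function.Injective pos)
    (hlt : ∀ u v, B.mult u v ≠ 0 → pos u < pos v) {M M' base : Fin N → ℝ} {x : Fin N}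
    (hM : ∀ v, M v = base v + ∑ u ∈ Finset.univ.filter (fun u => pos u < pos x),
      B.weight a u v * M u)
    (hM' : ∀ v, M' v = M v + B.weight a x v * M x) (v : Fin N) :
    M' v = base v + ∑ u ∈ Finset.univ.filter (fun u => pos u < pos x + 1),
      B.weight a u v * M' u := by
  have hold : ∀ u, pos u ≤ pos x → M' u = M u := fun u hu => by
    by_cases h0 : B.weight a x u = 0
    · rw [hM', h0, zero_mul, add_zero]
    · exact absurd (hlt _ _ (MRBDD.mult_ne_zero_of_weight h0)) (by omega)
  have hsum : ∑ u ∈ Finset.univ.filter (fun u => pos u < pos x), B.weight a u v * M' u =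
      ∑ u ∈ Finset.univ.filter (fun u => pos u < pos x), B.weight a u v * M u :=
    Finset.sum_congr rfl fun u hu => by rw [hold u (Finset.mem_filter.1 hu).2.le]
  rw [filter_lt_succ hinj, Finset.sum_insert (by simp), hM', hold x le_rfl, hM v, hsum]
  ring

theorem run_pushDown (h : s.Holds B a w) {x : Fin N} (hx : s.nat NVar.v = x) (v : Fin N) :
    ((ifNonterminal NVar.v (block [
      incR RArr.mTD (childT NVar.v)
        (RExp.mul (probT NVar.v) (RExp.get RArr.mTD (NExp.var NVar.v))),
      incR RArr.mTD (childF NVar.v)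
        (RExp.mul (probF NVar.v) (RExp.get RArr.mTD (NExp.var NVar.v)))])).run s).realArr
      RArr.mTD v = s.realArr RArr.mTD v + B.weight a x v * s.realArr RArr.mTD x := by
  rw [run_ifNonterminal h hx]
  cases hc : B.cell x with
  | zero => simp [MRBDD.weight, hc]
  | one => simp [MRBDD.weight, hc]
  | branch i t f =>
    have ht := h.childT x i t f hc
    have hf := h.childF x i t f hc
    -- A node is not its own child, so the second update reads the same message of `x` as the first.
    have hxt : x ≠ t := fun e => lt_irrefl _ (e ▸ B.rank_child hc (.inl rfl))
    set s₁ := s.storeR RArr.mTD t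
      (s.realArr RArr.mTD t + (1 - a i) / 2 * s.realArr RArr.mTD x) with hs₁
    -- Only the write set matters for the frame, so a simpler program that stores to `mTD` stands
    -- in.
    have h₁ : s₁.Holds B a w := h.frame
      (P := storeR RArr.mTD (childT NVar.v) (RExp.get RArr.mTD (NExp.var NVar.v)))
      ⟨fun _ _ => rfl, fun _ _ => rfl, fun A hA => by
        have : A ≠ RArr.mTD := by simpa [writesRArr] using hA
        simp [hs₁, this]⟩ rfl rfl rfl
    have hx₁ : s₁.nat NVar.v = x := hx
    have hstep₁ : (incR RArr.mTD (childT NVar.v)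
        (RExp.mul (probT NVar.v) (RExp.get RArr.mTD (NExp.var NVar.v)))).run s = s₁ := by
      simp only [incR, run, RExp.eval, probT_eval h hx hc, childT, NExp.eval, hx, ht, hs₁]
    have hf₁ : s₁.natArr NArr.childF x = f := hf
    have hx₂ : s₁.realArr RArr.mTD x = s.realArr RArr.mTD x := by
      simp [hs₁, Fin.val_inj, hxt]
    simp only [block, run.eq_6, hstep₁]
    simp only [incR, run, RExp.eval, probF_eval h₁ hx₁ hc, childF, NExp.eval, hx₁, hf₁, hx₂,
      Store.storeR_realArr, if_true, Function.update_apply, Fin.val_inj, MRBDD.weight_branch hc,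
      eq_comm (a := v)]
    simp only [hs₁, Store.storeR_realArr, if_true, Function.update_apply, Fin.val_inj]
    by_cases h1 : t = v <;> by_cases h2 : f = v
    · subst h1; subst h2; simp; ring
    · subst h1; simp [h2]
    · subst h2; simp [h1, Ne.symm h1]
    · simp [h1, h2, Ne.symm h1]

/-- The initialization assigns weights instead of adding them; `hent` ensures that no weight is
overwritten, so each node starts with the sum over its entries. -/
theorem evalTopDown_runs (h : s.Holds B a w) (hent : Function.Injective B.entry) :
    Runs evalTopDown s (1000 * N + 1000 * m + 1000)
      fun s' => B.IsTopDown a w (s'.vec RArr.mTD N) := by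
  refine Runs.mono (T := (N * 100 + 100) + ((m * 100 + 100) + ((500 * N + 500) +
    ((N * 100 + 100) + 100)))) (Q := fun s' => B.IsTopDown a w (s'.vec RArr.mTD N)) ?_
    (by omega) fun _ _ h => h
  refine Runs.seq (Runs.forTo_const (s₀ := s) N 100
    (fun k s => ∀ v : Fin N, v < k → s.realArr RArr.mTD v = 0) (by decide) rfl rfl
    (fun s' hf => (h.frame hf rfl rfl rfl).numNodes) (fun v hv => absurd hv (by omega))
    (fun k s' hf hk hI _ v hv => ?_)) fun s₁ hf₁ hs₁ => ?_
  · simp only [run, NExp.eval, RExp.eval, Store.setN_realArr, Store.storeR_realArr, if_true, hk,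
      Function.update_apply]
    split_ifs with hvk
    · simp
    · exact hI v (by omega)
  have h₁ : s₁.Holds B a w := h.frame hf₁ rfl rfl rfl
  refine Runs.seq (Runs.forTo_const (s₀ := s₁) m 100
    (fun k s => (∀ j : Fin m, (j : ℕ) < k → s.realArr RArr.mTD (B.entry j) = w j) ∧
      ∀ v : Fin N, (∀ j : Fin m, (j : ℕ) < k → B.entry j ≠ v) → s.realArr RArr.mTD v = 0)
    (by decide) rfl rfl
    (fun s' hf => (h₁.frame hf rfl rfl rfl).numConstr)
    ⟨fun j hj => absurd hj (by omega), fun v _ => hs₁ v v.isLt⟩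
    (fun k s' hf hk hI hkm => ?_)) fun s₂ hf₂ hs₂ => ?_
  · obtain ⟨j, rfl⟩ : ∃ j : Fin m, (j : ℕ) = k := ⟨⟨k, hkm⟩, rfl⟩
    have h' : s'.Holds B a w := h₁.frame hf rfl rfl rfl
    simp only [run, NExp.eval, RExp.eval, Store.setN_realArr, Store.storeR_realArr, if_true, hk,
      h'.entry, h'.weight, Function.update_apply, Fin.val_inj]
    refine ⟨fun l hl => ?_, fun v hv => ?_⟩
    · split_ifs with hlj
      · rw [hent hlj]
      · refine hI.1 l (lt_of_le_of_ne (by omega) fun e => hlj ?_)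
        rw [Fin.val_injective e]
    · rw [if_neg (Ne.symm (hv j (by omega)))]
      exact hI.2 v fun l hl => hv l (by omega)
  have h₂ : s₂.Holds B a w := h₁.frame hf₂ rfl rfl rfl
  have hbase : ∀ v : Fin N, s₂.realArr RArr.mTD v = ∑ j, if B.entry j = v then w j else 0 := by
    intro v
    by_cases hv : ∃ j, B.entry j = v
    · obtain ⟨j, rfl⟩ := hv
      simp only [hs₂.1 j j.isLt, hent.eq_iff, Finset.sum_ite_eq', Finset.mem_univ, if_true]
    · push Not at hv
      rw [hs₂.2 v fun j _ => hv j]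
      simp [hv]
  refine Runs.seq (topoSort_runs h₂) fun s₃ hf₃ hs₃ => ?_
  obtain ⟨pos, hpos⟩ := hs₃
  have h₃ : s₃.Holds B a w := h₂.frame hf₃ rfl rfl rfl
  refine Runs.seq (Runs.forTo_const (s₀ := s₃) N 100
    (fun k s => ∀ v : Fin N, s.realArr RArr.mTD v = (∑ j, if B.entry j = v then w j else 0) +
      ∑ u ∈ Finset.univ.filter (fun u => pos u < k), B.weight a u v * s.realArr RArr.mTD u)
    (by decide) rfl rfl (fun s' hf => (hf.nat NVar.len rfl).trans hpos.len)
    (fun v => ?_) (fun k s' hf hk hI hkN => ?_)) fun s₄ hf₄ hs₄ => ?_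
  · simp [hf₃.realArr RArr.mTD rfl, hbase]
  · obtain ⟨x, rfl⟩ := hpos.exists_pos k hkN
    have hget : s'.natArr NArr.list (pos x) = x := by rw [hf.natArr NArr.list rfl, hpos.get]
    set s₅ := s'.setN NVar.v x with hs₅
    have hf₅ : Frame (setN NVar.v (NExp.get NArr.list (NExp.var NVar.k))) s' s₅ := by
      have := (Exec.setN s' NVar.v (NExp.get NArr.list (NExp.var NVar.k))).frame
      simpa [NExp.eval, hk, hget] using this
    have h₅ : s₅.Holds B a w := (h₃.frame hf rfl rfl rfl).frame hf₅ rfl rfl rfl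
    have hrun := run_pushDown h₅ (x := x) (by simp [hs₅])
    simp only [block, run, NExp.eval, hk, hget, ← hs₅, Store.setN_realArr] at hrun ⊢
    exact topDown_step hpos.injective hpos.lt (M := fun v => s'.realArr RArr.mTD v)
      (M' := fun v => Store.realArr _ RArr.mTD v) hI hrun
  · refine (Runs.of_run (P := setR RVar.valTD (RExp.get RArr.mTD (NExp.var NVar.one))) rfl
      ?_).mono (by decide) fun _ _ h => h
    rw [MRBDD.isTopDown_iff]
    intro v
    have := hs₄ v
    rwa [Finset.filter_true_of_mem fun u _ => hpos.pos_lt u] at this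

/-! ## Bottom-up messages -/

/-- The linked list with first cell `p` and successor function `next` consists of the nodes in the
given list; its end is marked by `N`. -/
def IsLinked (next : ℕ → ℕ) : ℕ → List (Fin N) → Prop
  | p, [] => p = N
  | p, u :: l => p = u ∧ IsLinked next (next u) l

theorem IsLinked.congr {next next' : ℕ → ℕ} {p : ℕ} {l : List (Fin N)} (h : IsLinked next p l)
    (heq : ∀ u ∈ l, next' u = next u) : IsLinked next' p l := by
  induction l generalizing p with
  | nil => exact h
  | cons u l ih =>
    refine ⟨h.1, ?_⟩
    rw [heq u List.mem_cons_self]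
    exact ih h.2 fun v hv => heq v (List.mem_cons_of_mem _ hv)

/-- The heads of the lists of the parents through a `True` edge (`b = true`) or a `False` edge. -/
def headArr (b : Bool) : NArr := if b then NArr.headT else NArr.headF

/-- The successors in the lists of the parents. -/
def nextArr (b : Bool) : NArr := if b then NArr.nextT else NArr.nextF

/-- The linked list of each node `v` consists of the nodes with child `v` that satisfy `p`. -/
def ParentsRep (B : MRBDD n m N) (s : Store) (p : Fin N → Prop) : Prop :=
  ∀ b v, ∃ l : List (Fin N), IsLinked (s.natArr (nextArr b)) (s.natArr (headArr b) (v : Fin N)) l ∧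
    l.Nodup ∧ ∀ u, u ∈ l ↔ p u ∧ B.child b u = some v

/-- Insertion at the head. Since `x` is in no list so far, writing its successor damages none. One
successor array per kind suffices because a node has only one child of each kind. -/
theorem ParentsRep.insert {s s' : Store} {p : Fin N → Prop} {x : Fin N} (h : ParentsRep B s p)
    (hp : ¬ p x) (hs' : ∀ b, ∃ c, B.child b x = some c ∧
      s'.natArr (nextArr b) =
        Function.update (s.natArr (nextArr b)) x (s.natArr (headArr b) (c : Fin N)) ∧
      s'.natArr (headArr b) = Function.update (s.natArr (headArr b)) c x) :
    ParentsRep B s' fun u => p u ∨ u = x := by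
  intro b v
  obtain ⟨l, hl, hn, hm⟩ := h b v
  obtain ⟨c, hc, hnext, hhead⟩ := hs' b
  have hxl : x ∉ l := fun hx => hp ((hm x).1 hx).1
  have hl' : IsLinked (s'.natArr (nextArr b)) (s.natArr (headArr b) v) l := by
    refine hl.congr fun u hu => ?_
    rw [hnext, Function.update_of_ne]
    exact fun e => hxl (Fin.val_injective e ▸ hu)
  by_cases hv : c = v
  · subst hv
    refine ⟨x :: l, ⟨by rw [hhead, Function.update_self], ?_⟩, List.nodup_cons.2 ⟨hxl, hn⟩,
      fun u => ?_⟩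
    · rwa [hnext, Function.update_self, ← hnext]
    · rw [List.mem_cons, hm]
      constructor
      · rintro (rfl | ⟨h1, h2⟩)
        · exact ⟨.inr rfl, hc⟩
        · exact ⟨.inl h1, h2⟩
      · rintro ⟨h1 | h1, h2⟩
        · exact .inr ⟨h1, h2⟩
        · exact .inl h1
  · refine ⟨l, ?_, hn, fun u => ?_⟩
    · rwa [hhead, Function.update_of_ne fun e => hv (Fin.val_injective e).symm]
    · rw [hm]
      constructor
      · rintro ⟨h1, h2⟩
        exact ⟨.inl h1, h2⟩
      · rintro ⟨h1 | rfl, h2⟩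
        · exact ⟨h1, h2⟩
        · rw [hc] at h2
          exact absurd (Option.some_injective _ h2) hv

theorem buildParents_runs (h : s.Holds B a w) :
    Runs buildParents s (200 * N + 200) fun s' => ParentsRep B s' fun _ => True := by
  refine Runs.mono (T := (N * 100 + 100) + (N * 100 + 100))
    (Q := fun s' => ParentsRep B s' fun u => (u : ℕ) < N) ?_ (by omega)
    fun s' _ hs' b v => by simpa using hs' b v
  refine Runs.seq (Runs.forTo_const (s₀ := s) N 100
    (fun k s => ∀ b, ∀ v : Fin N, v < k → s.natArr (headArr b) v = N) (by decide) rfl rfl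
    (fun s' hf => (h.frame hf rfl rfl rfl).numNodes) (fun b v hv => absurd hv (by omega))
    (fun k s' hf hk hI _ b v hv => ?_)) fun s₁ hf₁ hs₁ => ?_
  · have h' : s'.Holds B a w := h.frame hf rfl rfl rfl
    have := hI b v
    cases b <;> simp only [headArr, if_true, Bool.false_eq_true, if_false] at this ⊢ <;>
    simp only [block, run, NExp.eval, Store.setN_natArr, Store.storeN_natArr, Store.storeN_nat, hk,
      Function.update_apply, h'.numNodes, if_true, reduceCtorEq, if_false] <;>
    · split_ifs with hvk
      · rfl
      · exact this (by omega)
  have h₁ : s₁.Holds B a w := h.frame hf₁ rfl rfl rfl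
  refine Runs.forTo_const (s₀ := s₁) N 100
    (fun k s => ParentsRep B s fun u => (u : ℕ) < k) (by decide) rfl rfl
    (fun s' hf => (h₁.frame hf rfl rfl rfl).numNodes)
    (fun b v => ⟨[], hs₁ b v v.isLt, List.nodup_nil, by simp⟩) (fun k s' hf hk hI hkN => ?_)
  have h' : s'.Holds B a w := h₁.frame hf rfl rfl rfl
  obtain ⟨x, rfl⟩ : ∃ x : Fin N, (x : ℕ) = k := ⟨⟨k, hkN⟩, rfl⟩
  have hterm : (∀ b, B.child b x = none) → ParentsRep B s' fun u => (u : ℕ) < x + 1 := by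
    intro hx b v
    obtain ⟨l, hl, hn, hm⟩ := hI b v
    refine ⟨l, hl, hn, fun u => ?_⟩
    rw [hm]
    constructor
    · rintro ⟨h1, h2⟩
      exact ⟨by omega, h2⟩
    · rintro ⟨h1, h2⟩
      rcases Nat.lt_succ_iff_lt_or_eq.1 h1 with h1 | h1
      · exact ⟨h1, h2⟩
      · rw [Fin.val_injective h1, hx] at h2
        cases h2
  rw [run_ifNonterminal h' hk]
  cases hc : B.cell x with
  | zero => exact hterm fun b => by simp [MRBDD.child, hc]
  | one => exact hterm fun b => by simp [MRBDD.child, hc]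
  | branch i t f =>
    have ht := h'.childT x i t f hc
    have hf := h'.childF x i t f hc
    have := hI.insert (x := x) (by simp) (s' := ((block [
      storeN NArr.nextT (NExp.var NVar.u) (NExp.get NArr.headT (childT NVar.u)),
      storeN NArr.headT (childT NVar.u) (NExp.var NVar.u),
      storeN NArr.nextF (NExp.var NVar.u) (NExp.get NArr.headF (childF NVar.u)),
      storeN NArr.headF (childF NVar.u) (NExp.var NVar.u)]).run s').setN NVar.u (x + 1))
      (fun b => ⟨if b then t else f, by simp [MRBDD.child, hc], by
        cases b <;> simp [nextArr, headArr, block, run, NExp.eval, childT, childF, hk, ht, hf], by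
        cases b <;> simp [headArr, block, run, NExp.eval, childT, childF, hk, ht, hf]⟩)
    have heq : (fun u : Fin N => (u : ℕ) < x + 1) = fun u : Fin N => (u : ℕ) < x ∨ u = x := by
      ext u
      rw [Nat.lt_succ_iff_lt_or_eq, Fin.val_inj]
    rw [heq]
    exact this

/-- The loop over the parents of `x` adds to the message of each parent. -/
theorem forParents_runs {hd nxt : NArr} {e : RExp} {x : Fin N} {l : List (Fin N)}
    {q : Fin N → ℝ} (hN : s.nat NVar.numNodes = N) (hx : s.nat NVar.v = x)
    (hl : IsLinked (s.natArr nxt) (s.natArr hd x) l) (hn : l.Nodup) (hxl : x ∉ l)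
    (hc : e.cost ≤ 50)
    (he : ∀ s', Frame (forParents hd nxt (incR RArr.mBU (NExp.var NVar.u)
      (RExp.mul e (RExp.get RArr.mBU (NExp.var NVar.v))))) s s' →
      ∀ u ∈ l, s'.nat NVar.u = u → e.eval s' = q u) :
    Runs (forParents hd nxt (incR RArr.mBU (NExp.var NVar.u)
      (RExp.mul e (RExp.get RArr.mBU (NExp.var NVar.v))))) s (l.length * 100 + 100)
      fun s' => ∀ v : Fin N, s'.realArr RArr.mBU v =
        s.realArr RArr.mBU v + if v ∈ l then q v * s.realArr RArr.mBU x else 0 := by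
  set body := incR RArr.mBU (NExp.var NVar.u) (RExp.mul e (RExp.get RArr.mBU (NExp.var NVar.v)))
    with hbody
  refine Runs.mono (T := 3 + (l.length * 100 + 10)) (Q := fun s' => ∀ v : Fin N,
    s'.realArr RArr.mBU v = s.realArr RArr.mBU v + if v ∈ l then q v * s.realArr RArr.mBU x else 0)
    ?_ (by omega) fun _ _ h => h
  refine Runs.seq (T := 3) (Q := fun s' => s' = s.setN NVar.u (s.natArr hd x))
    ((Runs.of_run rfl rfl).mono le_rfl fun s' _ hs' => by
      rw [← hs']; simp [run, NExp.eval, hx]) fun s₁ hf₁ hs₁ => ?_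
  -- The parents `l₁` are done and `l₂` remain; each remaining parent is allotted 100 steps, and 10
  -- are kept for the last test.
  refine Runs.loop (fun T s' => ∃ l₁ l₂ : List (Fin N), l = l₁ ++ l₂ ∧ T = l₂.length * 100 + 10 ∧
    IsLinked (s.natArr nxt) (s'.nat NVar.u) l₂ ∧ ∀ v : Fin N, s'.realArr RArr.mBU v =
      s.realArr RArr.mBU v + if v ∈ l₁ then q v * s.realArr RArr.mBU x else 0) ?_
    ⟨[], l, rfl, rfl, by simpa [hs₁] using hl, by simp [hs₁]⟩
  rintro T s' hf' ⟨l₁, l₂, rfl, rfl, hl₂, hM⟩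
  have hf : Frame (forParents hd nxt body) s s' :=
    (Frame.seq_left hf₁).trans (Frame.seq_right hf'.toLoop)
  have hN' : s'.nat NVar.numNodes = N := by
    rw [hf.nat _ (by simp [forParents, block, writesVar, hbody, incR]), hN]
  have hx' : s'.nat NVar.v = x := by
    rw [hf.nat _ (by simp [forParents, block, writesVar, hbody, incR]), hx]
  have hnxt : s'.natArr nxt = s.natArr nxt :=
    hf.natArr _ (by simp [forParents, block, writesNArr, hbody, incR])
  cases l₂ with
  | nil =>
    have hu : s'.nat NVar.u = N := hl₂
    simp only [BExp.eval, NExp.eval, hN', hu]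
    refine ⟨fun _ => ⟨by simp [BExp.cost, NExp.cost], by simpa using hM⟩, fun hb => ?_⟩
    simp at hb
  | cons u l₂ =>
    have hu : s'.nat NVar.u = u := hl₂.1
    simp only [BExp.eval, NExp.eval, hN', hu]
    refine ⟨fun hb => by simp at hb, fun _ => ⟨97, l₂.length * 100 + 10, ?_, ?_⟩⟩
    · simp only [BExp.cost, NExp.cost, List.length_cons]
      omega
    · refine Runs.mono (Runs.of_run rfl ⟨l₁ ++ [u], l₂, by simp, rfl, ?_, fun v => ?_⟩) ?_
        fun _ _ h => h
      · simp only [block, bound, hbody, incR, NExp.cost, RExp.cost]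
        omega
      · simpa [block, run, hbody, incR, NExp.eval, hu, hnxt] using hl₂.2
      · have hul₁ : u ∉ l₁ := fun hu' =>
          (List.nodup_append.1 hn).2.2 u hu' u List.mem_cons_self rfl
        -- `x` is not among its own parents, so its message is still the initial one.
        have hxl₁ : x ∉ l₁ := fun hx => hxl (List.mem_append_left _ hx)
        simp only [block, run, hbody, incR, NExp.eval, RExp.eval, hu, hx',
          he s' hf u (by simp) hu, Store.setN_realArr, Store.storeR_realArr, if_true,
          Function.update_apply, Fin.val_inj, hM, if_neg hxl₁, add_zero, List.mem_append,
          List.mem_singleton]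
        by_cases hvu : v = u
        · subst hvu
          simp [hul₁]
        · simp [hvu]

/-- The bottom-up equations, restricted to the messages of the nodes at positions from `k` on. -/
def BottomUpFrom (B : MRBDD n m N) (a : EuclideanSpace ℝ (Fin n)) (pos : Fin N → ℕ) (k : ℕ)
    (M : Fin N → ℝ) : Prop :=
  ∀ v, M v = (if v = B.one then 1 else 0) +
    ∑ b, match B.child b v with
      | some t => if k ≤ pos t then B.prob a b v * M t else 0
      | none => 0

/-- Parents of `x` lie strictly before `x`, so the messages at positions from `pos x` on do not
change. The visit therefore adds exactly the terms of the edges into `x`. -/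
theorem BottomUpFrom.step {pos : Fin N → ℕ} (hinj : Function.Injective pos)
    (hlt : ∀ u v, B.mult u v ≠ 0 → pos u < pos v) {M M' : Fin N → ℝ} {x : Fin N}
    (hM : BottomUpFrom B a pos (pos x + 1) M)
    (hM' : ∀ v, M' v = M v + ∑ b, if B.child b v = some x then B.prob a b v * M x else 0) :
    BottomUpFrom B a pos (pos x) M' := by
  have hold : ∀ u, pos x ≤ pos u → M' u = M u := fun u hu => by
    rw [hM', Finset.sum_eq_zero, add_zero]
    intro b _
    rw [if_neg]
    intro hb
    exact absurd (hlt u x (B.mult_ne_zero_iff.2 ⟨b, hb⟩)) (by omega)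
  intro v
  rw [hM', hM v, add_assoc, ← Finset.sum_add_distrib]
  congr 1
  refine Finset.sum_congr rfl fun b _ => ?_
  cases hb : B.child b v with
  | none => simp
  | some t =>
    simp only [Option.some_inj]
    by_cases htx : t = x
    · subst htx
      rw [if_neg (by omega), if_pos rfl, if_pos le_rfl, hold t le_rfl, zero_add]
    · have hne : pos t ≠ pos x := fun e => htx (hinj e)
      rw [if_neg htx, add_zero]
      split_ifs with h1 h2 h2
      · rw [hold t h2]
      · omega
      · omega
      · rfl

/-- The number of edges of the given kind into `v`. -/
def MRBDD.degree (B : MRBDD n m N) (b : Bool) (v : Fin N) : ℕ :=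
  (Finset.univ.filter fun u => B.child b u = some v).card

/-- Double counting: each node has at most one child of the given kind. This makes the total cost of
the parent loops linear. -/
theorem MRBDD.sum_degree_le (B : MRBDD n m N) (b : Bool) : ∑ v, B.degree b v ≤ N := by
  simp only [degree, Finset.card_filter]
  rw [Finset.sum_comm]
  calc ∑ u, ∑ v, (if B.child b u = some v then 1 else 0) ≤ ∑ _u : Fin N, 1 := by
        refine Finset.sum_le_sum fun u _ => ?_
        cases B.child b u with
        | none => simp
        | some t => simp
    _ = N := by simp

theorem pullUp_runs (h : s.Holds B a w) (hpar : ParentsRep B s fun _ => True) {x : Fin N}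
    (hx : s.nat NVar.v = x) :
    Runs (.seq
      (forParents NArr.headT NArr.nextT (incR RArr.mBU (NExp.var NVar.u)
        (RExp.mul (probT NVar.u) (RExp.get RArr.mBU (NExp.var NVar.v)))))
      (forParents NArr.headF NArr.nextF (incR RArr.mBU (NExp.var NVar.u)
        (RExp.mul (probF NVar.u) (RExp.get RArr.mBU (NExp.var NVar.v)))))) s
      ((B.degree true x * 100 + 100) + (B.degree false x * 100 + 100))
      fun s' => ∀ v : Fin N, s'.realArr RArr.mBU v = s.realArr RArr.mBU v +
        ∑ b, if B.child b v = some x then B.prob a b v * s.realArr RArr.mBU x else 0 := by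
  have hlen : ∀ {b} {l : List (Fin N)}, l.Nodup → (∀ u, u ∈ l ↔ True ∧ B.child b u = some x) →
      l.length = B.degree b x := fun {b l} hn hm => by
    rw [← List.toFinset_card_of_nodup hn, MRBDD.degree]
    congr 1
    ext u
    simp [hm]
  have hself : ∀ {b} {l : List (Fin N)}, (∀ u, u ∈ l ↔ True ∧ B.child b u = some x) → x ∉ l :=
    fun {b l} hm hxl => B.mult_ne_zero_iff.2 ⟨b, ((hm x).1 hxl).2⟩ (B.mult_self x)
  obtain ⟨l, hl, hn, hm⟩ := hpar true x
  obtain ⟨l', hl', hn', hm'⟩ := hpar false x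
  have r₁ := forParents_runs (e := probT NVar.u) (q := B.prob a true) h.numNodes hx hl hn
    (hself hm) (by decide) (fun s' hf u hu hus => by
      have h' : s'.Holds B a w := h.frame hf rfl rfl rfl
      cases hc : B.cell u with
      | zero => simp [hm, MRBDD.child, hc] at hu
      | one => simp [hm, MRBDD.child, hc] at hu
      | branch i t f => rw [probT_eval h' hus hc]; simp [MRBDD.prob, hc])
  rw [hlen hn hm] at r₁
  refine Runs.seq r₁ fun s₁ hf₁ hs₁ => ?_
  have h₁ : s₁.Holds B a w := h.frame hf₁ rfl rfl rfl
  have r₂ := forParents_runs (s := s₁) (hd := NArr.headF) (nxt := NArr.nextF)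
    (e := probF NVar.u) (q := B.prob a false) h₁.numNodes ((hf₁.nat NVar.v rfl).trans hx)
    (l := l') (by rwa [hf₁.natArr NArr.nextF rfl, hf₁.natArr NArr.headF rfl]) hn'
    (hself hm') (by decide) (fun s' hf u hu hus => by
      have h' : s'.Holds B a w := h₁.frame hf rfl rfl rfl
      cases hc : B.cell u with
      | zero => simp [hm', MRBDD.child, hc] at hu
      | one => simp [hm', MRBDD.child, hc] at hu
      | branch i t f => rw [probF_eval h' hus hc]; simp [MRBDD.prob, hc])
  rw [hlen hn' hm'] at r₂
  refine r₂.mono le_rfl fun s' _ hs' v => ?_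
  -- The first pass leaves the message of `x` unchanged, so both passes multiply by the same value.
  rw [hs', hs₁, hs₁ x, if_neg (hself hm)]
  simp only [hm, hm', true_and, Fintype.sum_bool, add_zero]
  ring

theorem evalBottomUp_runs (h : s.Holds B a w) :
    Runs evalBottomUp s (2000 * N + 1000 * m + 2000)
      fun s' => B.IsBottomUp a (s'.vec RArr.mBU N) := by
  refine Runs.mono (T := (N * 100 + 100) + (3 + ((500 * N + 500) + ((200 * N + 200) + (2 +
    ((600 * N + 10) + (2 + (m * 100 + 100))))))))
    (Q := fun s' => B.IsBottomUp a (s'.vec RArr.mBU N)) ?_ (by omega) fun _ _ h => h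
  refine Runs.seq (Runs.forTo_const (s₀ := s) N 100
    (fun k s => ∀ v : Fin N, v < k → s.realArr RArr.mBU v = 0) (by decide) rfl rfl
    (fun s' hf => (h.frame hf rfl rfl rfl).numNodes) (fun v hv => absurd hv (by omega))
    (fun k s' hf hk hI _ v hv => ?_)) fun s₁ hf₁ hs₁ => ?_
  · simp only [run, NExp.eval, RExp.eval, Store.setN_realArr, Store.storeR_realArr, if_true, hk,
      Function.update_apply]
    split_ifs with hvk
    · simp
    · exact hI v (by omega)
  have h₁ : s₁.Holds B a w := h.frame hf₁ rfl rfl rfl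
  refine Runs.seq (T := 3) (Q := fun s' => ∀ v : Fin N, s'.realArr RArr.mBU v =
    if v = B.one then 1 else 0) (Runs.of_run rfl fun v => ?_) fun s₂ hf₂ hs₂ => ?_
  · simp only [run, NExp.eval, RExp.eval, Store.storeR_realArr, if_true, h₁.one,
      Function.update_apply, Fin.val_inj, hs₁ v v.isLt, Nat.cast_one]
  have h₂ : s₂.Holds B a w := h₁.frame hf₂ rfl rfl rfl
  refine Runs.seq (topoSort_runs h₂) fun s₃ hf₃ hs₃ => ?_
  obtain ⟨pos, hpos⟩ := hs₃
  have h₃ : s₃.Holds B a w := h₂.frame hf₃ rfl rfl rfl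
  refine Runs.seq (buildParents_runs h₃) fun s₄ hf₄ hs₄ => ?_
  have h₄ : s₄.Holds B a w := h₃.frame hf₄ rfl rfl rfl
  refine Runs.seq (T := 2) (Q := fun s' => s'.nat NVar.k = N ∧ s'.natArr = s₄.natArr ∧
    s'.realArr = s₄.realArr) (Runs.of_run rfl ?_) fun s₅ hf₅ hs₅ => ?_
  · refine ⟨?_, rfl, rfl⟩
    simp only [run, NExp.eval, Store.setN_nat, if_true, hf₄.nat NVar.len rfl, hpos.len]
  have h₅ : s₅.Holds B a w := h₄.frame hf₅ rfl rfl rfl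
  refine Runs.seq (Q := fun s' => B.IsBottomUp a (s'.vec RArr.mBU N)) (T := 600 * N + 10)
    -- Amortized cost: each unvisited node reserves 400 steps plus 100 per incoming edge, and 10 are
    -- kept for the last test. In total this is at most `400 * N + 2 * (100 * N) + 10`.
    (Runs.loop (fun T s' => ∃ k, s'.nat NVar.k = k ∧ k ≤ N ∧
      BottomUpFrom B a pos k (s'.vec RArr.mBU N) ∧
      ∑ v ∈ Finset.univ.filter (fun v => pos v < k),
        (400 + (B.degree true v * 100 + B.degree false v * 100)) + 10 ≤ T) ?_
      ⟨N, hs₅.1, le_rfl, fun v => ?_, ?_⟩) fun s₆ hf₆ hs₆ => ?_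
  · rintro T s' hf ⟨k, hk, hkN, hI, hT⟩
    constructor
    · intro hb
      simp only [BExp.eval, NExp.eval, hk, decide_eq_false_iff_not, not_lt, Nat.le_zero] at hb
      subst hb
      refine ⟨by simp only [BExp.cost, NExp.cost]; omega, MRBDD.isBottomUp_of fun v => ?_⟩
      simpa using hI v
    · intro hb
      simp only [BExp.eval, NExp.eval, hk, decide_eq_true_eq] at hb
      obtain ⟨k, rfl⟩ : ∃ k', k = k' + 1 := ⟨k - 1, by omega⟩
      obtain ⟨x, rfl⟩ := hpos.exists_pos k (by omega)
      rw [filter_lt_succ hpos.injective, Finset.sum_insert (by simp)] at hT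
      refine ⟨4 + (3 + ((B.degree true x * 100 + 100) + (B.degree false x * 100 + 100))),
        T - (4 + 4 + (3 + ((B.degree true x * 100 + 100) + (B.degree false x * 100 + 100)))), ?_,
        Runs.seq (T := 4) (Q := fun s'' => s'' = s'.setN NVar.k (pos x)) (Runs.of_run rfl ?_)
        fun s₆ hf₆ hs₆ => ?_⟩
      · simp only [BExp.cost, NExp.cost]
        omega
      · simp [run, NExp.eval, hk]
      refine Runs.seq (T := 3) (Q := fun s'' => s'' = s₆.setN NVar.v x) (Runs.of_run rfl ?_)
        fun s₇ hf₇ hs₇ => ?_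
      · have : s₆.natArr NArr.list (pos x) = x := by
          rw [hf₆.natArr NArr.list rfl, hf.natArr NArr.list rfl, hf₅.natArr NArr.list rfl,
            hf₄.natArr NArr.list rfl, hpos.get]
        have hk₆ : s₆.nat NVar.k = pos x := by simp [hs₆]
        simp only [run, NExp.eval, hk₆, this]
      have h₇ : s₇.Holds B a w :=
        ((h₅.frame hf rfl rfl rfl).frame hf₆ rfl rfl rfl).frame hf₇ rfl rfl rfl
      have hpar₇ : ParentsRep B s₇ fun _ => True := by
        have hA : ∀ A ∈ [NArr.headT, NArr.headF, NArr.nextT, NArr.nextF],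
            s₇.natArr A = s₄.natArr A := fun A hA => by
          rw [hs₇, hs₆, Store.setN_natArr, Store.setN_natArr, ← hs₅.2.1]
          refine hf.natArr A ?_
          simp only [List.mem_cons, List.not_mem_nil, or_false] at hA
          rcases hA with rfl | rfl | rfl | rfl <;> rfl
        intro b v
        rw [hA (nextArr b) (by cases b <;> simp [nextArr]),
          hA (headArr b) (by cases b <;> simp [headArr])]
        exact hs₄ b v
      refine (pullUp_runs h₇ hpar₇ (x := x) (by simp [hs₇])).mono le_rfl fun s₈ hf₈ hs₈ => ?_
      refine ⟨pos x, ?_, by omega, ?_, by omega⟩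
      · rw [hf₈.nat NVar.k rfl, hs₇, hs₆]
        simp
      · refine hI.step hpos.injective hpos.lt fun v => ?_
        have := hs₈ v
        rwa [hs₇, hs₆] at this
  · have heq : s₅.realArr RArr.mBU = s₂.realArr RArr.mBU := by
      rw [hs₅.2.2, hf₄.realArr RArr.mBU rfl, hf₃.realArr RArr.mBU rfl]
    simp only [Store.vec, heq, hs₂]
    rw [Finset.sum_eq_zero, add_zero]
    intro b _
    cases B.child b v with
    | none => rfl
    | some t => exact if_neg (not_le.2 (hpos.pos_lt t))
  · rw [Finset.filter_true_of_mem fun u _ => hpos.pos_lt u]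
    have h1 := B.sum_degree_le true
    have h2 := B.sum_degree_le false
    simp only [Finset.sum_add_distrib, ← Finset.sum_mul]
    simp
    omega
  · refine Runs.seq (T := 2) (Q := fun s' => s'.realArr = s₆.realArr) (Runs.of_run rfl rfl)
      fun s₇ hf₇ hs₇ => ?_
    have h₇ : s₇.Holds B a w := (h₅.frame hf₆ rfl rfl rfl).frame hf₇ rfl rfl rfl
    -- This loop only accumulates the objective value in `valBU`; the messages are untouched, so
    -- only its cost matters.
    refine Runs.mono (Runs.forTo_const (s₀ := s₇) m 100 (fun _ _ => True) (by decide) rfl rfl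
      (fun s' hf => (h₇.frame hf rfl rfl rfl).numConstr) trivial
      fun _ _ _ _ _ _ => trivial) le_rfl fun s' hf _ => ?_
    have : s'.vec RArr.mBU N = s₆.vec RArr.mBU N := by
      unfold Store.vec
      rw [hf.realArr RArr.mBU rfl, hs₇]
    rwa [this]

end

/-! ## The Walsh-Fourier expansion as an expectation -/

/-- The probability of the assignment `y` if the variables are independent with expectations `x i`
(for `x` in the cube). -/
noncomputable def assignProb {n : ℕ} (x : EuclideanSpace ℝ (Fin n)) (y : Fin n → Bool) : ℝ :=
  ∏ i, (1 + x i * sgn (y i)) / 2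

/-- Multiply out `∏ i, (1 + x i * sgn (y i))`: each set `S` contributes the product of its
characters at `y` and at `x`. Then exchange the sums over `S` and `y`. -/
theorem wfe_eq_sum {n : ℕ} (f : BoolFun n) (x : EuclideanSpace ℝ (Fin n)) :
    wfe f x = ∑ y, (if f y then 1 else 0) * assignProb x y := by
  have h : ∀ y, assignProb x y =
      ∑ S : Finset (Fin n), 1 / 2 ^ n * ((∏ i ∈ S, sgn (y i)) * ∏ i ∈ S, x i) := fun y => by
    rw [assignProb, Finset.prod_div_distrib, Finset.prod_one_add, Finset.powerset_univ,
      ← Finset.mul_sum]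
    simp only [Finset.prod_mul_distrib, Finset.prod_const, Finset.card_univ, Fintype.card_fin]
    simp only [mul_comm (∏ i ∈ _, x i)]
    ring
  simp only [wfe, fourierCoeff, h, Finset.mul_sum, Finset.sum_mul]
  rw [Finset.sum_comm]
  exact Finset.sum_congr rfl fun y _ => Finset.sum_congr rfl fun S _ => by ring

/-- By distributivity the sum is a product of factors `(1 - x i) / 2 + (1 + x i) / 2 = 1`. -/
theorem sum_assignProb {n : ℕ} (x : EuclideanSpace ℝ (Fin n)) : ∑ y, assignProb x y = 1 := by
  have h := Finset.prod_univ_sum (fun _ : Fin n => (Finset.univ : Finset Bool))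
    (fun i b => (1 + x i * sgn b) / 2)
  rw [Fintype.piFinset_univ] at h
  simp only [assignProb]
  rw [← h]
  refine Finset.prod_eq_one fun i _ => ?_
  simp only [Fintype.sum_bool, sgn, if_true, Bool.false_eq_true, if_false]
  ring

/-- The value of the variable `i` is independent of a function that does not depend on it. -/
theorem sum_ite_mul_assignProb {n : ℕ} (x : EuclideanSpace ℝ (Fin n)) (i : Fin n) (b : Bool)
    {h : (Fin n → Bool) → ℝ} (hh : ∀ y c, h (Function.update y i c) = h y) :
    ∑ y, (if y i = b then h y else 0) * assignProb x y =
      (1 + x i * sgn b) / 2 * ∑ y, h y * assignProb x y := by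
  set r : (Fin n → Bool) → ℝ := fun y => h y * ∏ j ∈ Finset.univ.erase i, (1 + x j * sgn (y j)) / 2
    with hr
  have hrinv : ∀ y c, r (Function.update y i c) = r y := fun y c => by
    simp only [hr, hh]
    congr 1
    refine Finset.prod_congr rfl fun j hj => ?_
    rw [Function.update_of_ne (Finset.ne_of_mem_erase hj)]
  have hfac : ∀ y, h y * assignProb x y = (1 + x i * sgn (y i)) / 2 * r y := fun y => by
    rw [assignProb, ← Finset.mul_prod_erase _ _ (Finset.mem_univ i)]
    ring
  have hinv : Function.Involutive fun y : Fin n → Bool => Function.update y i (!y i) := fun y => by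
    simp
  -- Flipping coordinate `i` swaps the two halves of the cube and preserves `r`. Both halves thus
  -- have equal sums, and their factors `(1 ± x i) / 2` add up to 1.
  have hflip : ∀ c, (∑ y, if y i = c then r y else 0) = ∑ y, if y i = !c then r y else 0 := by
    intro c
    rw [← Equiv.sum_comp hinv.toPerm]
    refine Finset.sum_congr rfl fun y _ => ?_
    simp only [Function.Involutive.coe_toPerm, Function.update_self, hrinv]
    cases y i <;> cases c <;> simp
  have hsplit : ∀ c, ∑ y, (if y i = c then h y else 0) * assignProb x y =
      (1 + x i * sgn c) / 2 * ∑ y, if y i = c then r y else 0 := by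
    intro c
    rw [Finset.mul_sum]
    refine Finset.sum_congr rfl fun y _ => ?_
    split_ifs with hc
    · rw [hfac, hc]
    · simp
  have htot : ∑ y, h y * assignProb x y =
      ∑ y, (if y i = b then h y else 0) * assignProb x y +
        ∑ y, (if y i = !b then h y else 0) * assignProb x y := by
    rw [← Finset.sum_add_distrib]
    refine Finset.sum_congr rfl fun y _ => ?_
    cases y i <;> cases b <;> simp
  rw [htot, hsplit, hsplit, ← hflip]
  cases b <;> simp only [sgn, if_true, Bool.false_eq_true, if_false, Bool.not_true, Bool.not_false]
    <;> ring

theorem differentiable_assignProb {n : ℕ} (y : Fin n → Bool) :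
    Differentiable ℝ fun x : EuclideanSpace ℝ (Fin n) => assignProb x y := by
  unfold assignProb
  fun_prop

/-! ## Messages -/

namespace MRBDD

variable {n m N : ℕ} (B : MRBDD n m N)

theorem eval_branch {v t f : Fin N} {i : Fin n} (h : B.cell v = Cell.branch i t f)
    (y : Fin n → Bool) : B.eval y v = if y i then B.eval y t else B.eval y f := by
  rw [eval]
  split <;> simp_all

/-- The order increases along edges, so no path from `v` ever queries variable `i`. -/
theorem eval_update {y : Fin n → Bool} {i : Fin n} (b : Bool) (v : Fin N)
    (h : ∀ j t f, B.cell v = Cell.branch j t f → B.order i < B.order j) :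
    B.eval (Function.update y i b) v = B.eval y v := by
  induction hr : B.rank v using Nat.strong_induction_on generalizing v with
  | _ r ih =>
    subst hr
    cases hc : B.cell v with
    | zero =>
      rw [eval, eval]
      split <;> simp_all
    | one =>
      rw [eval, eval]
      split <;> simp_all
    | branch j t f =>
      have hij := h j t f hc
      have hne : j ≠ i := fun e => lt_irrefl _ (e ▸ hij)
      rw [eval_branch B hc, eval_branch B hc, Function.update_of_ne hne,
        ih _ (B.rank_child hc (.inl rfl)) t
          (fun k t' f' hk => hij.trans (B.ordered v j t f hc t (.inl rfl) k t' f' hk)) rfl,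
        ih _ (B.rank_child hc (.inr rfl)) f
          (fun k t' f' hk => hij.trans (B.ordered v j t f hc f (.inr rfl) k t' f' hk)) rfl]

/-- The expected value at the node `v`. -/
noncomputable def expect (v : Fin N) (x : EuclideanSpace ℝ (Fin n)) : ℝ :=
  ∑ y, (if B.eval y v then 1 else 0) * assignProb x y

/-- Shannon expansion: split by the value of variable `i`, of which both children are independent.
-/
theorem expect_branch {v t f : Fin N} {i : Fin n} (h : B.cell v = Cell.branch i t f)
    (x : EuclideanSpace ℝ (Fin n)) :
    B.expect v x = (1 - x i) / 2 * B.expect t x + (1 + x i) / 2 * B.expect f x := by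
  have key : ∀ u, u = t ∨ u = f → ∀ b, ∑ y,
      (if y i = b then (if B.eval y u then (1 : ℝ) else 0) else 0) * assignProb x y =
      (1 + x i * sgn b) / 2 * B.expect u x := fun u hu b =>
    sum_ite_mul_assignProb x i b (h := fun y => if B.eval y u then 1 else 0) fun y c => by
      rw [B.eval_update c u (B.ordered v i t f h u hu)]
  have ht := key t (.inl rfl) true
  have hf := key f (.inr rfl) false
  simp only [sgn, if_true, Bool.false_eq_true, if_false, mul_neg, mul_one, ← sub_eq_add_neg]
    at ht hf
  rw [← ht, ← hf, expect, ← Finset.sum_add_distrib]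
  refine Finset.sum_congr rfl fun y _ => ?_
  rw [B.eval_branch h]
  cases y i <;> simp

theorem isBottomUp_expect (a : EuclideanSpace ℝ (Fin n)) :
    B.IsBottomUp a fun v => B.expect v a := by
  intro v
  cases hc : B.cell v with
  | zero =>
    have : ∀ y, B.eval y v = false := fun y => by rw [eval]; split <;> simp_all
    simp [expect, this]
  | one =>
    have : ∀ y, B.eval y v = true := fun y => by rw [eval]; split <;> simp_all
    simp [expect, this, sum_assignProb]
  | branch i t f => exact B.expect_branch hc a

variable {B}

/-- The equations are a recursion on `rank`. With `isBottomUp_expect` this identifies the computed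
messages with `expect`. -/
theorem IsBottomUp.unique {a : EuclideanSpace ℝ (Fin n)} {M M' : Fin N → ℝ}
    (h : B.IsBottomUp a M) (h' : B.IsBottomUp a M') (v : Fin N) : M v = M' v := by
  induction hr : B.rank v using Nat.strong_induction_on generalizing v with
  | _ r ih =>
    subst hr
    rw [h v, h' v]
    cases hc : B.cell v with
    | zero => rfl
    | one => rfl
    | branch i t f =>
      simp only
      rw [ih _ (B.rank_child hc (.inl rfl)) t rfl, ih _ (B.rank_child hc (.inr rfl)) f rfl]

variable (B)

theorem differentiable_expect (v : Fin N) : Differentiable ℝ (B.expect v) := by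
  unfold expect
  have := differentiable_assignProb (n := n)
  fun_prop

/-- The product rule applied to `expect_branch`; the last term stems from the derivatives `-1/2` and
`1/2` of the edge probabilities. -/
theorem fderiv_expect_branch {v t f : Fin N} {i : Fin n} (h : B.cell v = Cell.branch i t f)
    (a e : EuclideanSpace ℝ (Fin n)) :
    fderiv ℝ (B.expect v) a e = (1 - a i) / 2 * fderiv ℝ (B.expect t) a e +
      (1 + a i) / 2 * fderiv ℝ (B.expect f) a e + e i / 2 * (B.expect f a - B.expect t a) := by
  have hp : HasFDerivAt (fun x : EuclideanSpace ℝ (Fin n) => x i)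
      (EuclideanSpace.proj i : EuclideanSpace ℝ (Fin n) →L[ℝ] ℝ) a :=
    (EuclideanSpace.proj i : EuclideanSpace ℝ (Fin n) →L[ℝ] ℝ).hasFDerivAt
  have ht := (B.differentiable_expect t a).hasFDerivAt
  have hf := (B.differentiable_expect f a).hasFDerivAt
  have hv := (((hp.const_sub 1).mul_const (1 / 2)).mul ht).add
    (((hp.const_add 1).mul_const (1 / 2)).mul hf)
  have hv' := hv.congr_of_eventuallyEq (f₁ := B.expect v) (.of_forall fun x => by
    simp only [Pi.add_apply, Pi.mul_apply, B.expect_branch h x]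
    ring)
  rw [hv'.fderiv]
  simp only [add_apply, smul_apply, neg_apply, PiLp.proj_apply, smul_eq_mul]
  ring

theorem objective_eq {c : Fin m → BoolFun n} (hc : B.Represents c) (w : Fin m → ℝ) :
    objective c w = fun x => ∑ j, w j * B.expect (B.entry j) x := by
  funext x
  simp only [objective, wfe_eq_sum, expect, hc _ _]

/-- Reverse-mode differentiation: the top-down messages solve the transpose of the linear system for
the derivatives `D`, so pairing them with `D` cancels all contributions of edges. -/
theorem hasGradientAt_objective {c : Fin m → BoolFun n} (hc : B.Represents c) {w : Fin m → ℝ}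
    {a : EuclideanSpace ℝ (Fin n)} {MTD MBU : Fin N → ℝ} (hTD : B.IsTopDown a w MTD)
    (hBU : B.IsBottomUp a MBU) :
    HasGradientAt (objective c w) (WithLp.toLp 2 fun i => 1 / 2 * B.combine MTD MBU i) a := by
  rw [hasGradientAt_iff_hasFDerivAt, B.objective_eq hc]
  have hd : HasFDerivAt (fun x => ∑ j, w j * B.expect (B.entry j) x)
      (∑ j, w j • fderiv ℝ (B.expect (B.entry j)) a) a :=
    HasFDerivAt.fun_sum fun j _ => ((B.differentiable_expect _ a).hasFDerivAt).const_mul _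
  refine hd.congr_fderiv (ContinuousLinearMap.ext fun e => ?_)
  rw [InnerProductSpace.toDual_apply_apply]
  have hMBU := hBU.unique (B.isBottomUp_expect a)
  rw [isTopDown_iff] at hTD
  set D : Fin N → ℝ := fun v => fderiv ℝ (B.expect v) a e with hD
  -- Insert the top-down equations and move the transposed matrix over to `D`.
  have h1 : ∑ v, MTD v * D v = (∑ j, w j * D (B.entry j)) +
      ∑ u, MTD u * ∑ v, B.weight a u v * D v := by
    rw [Finset.sum_congr rfl fun v _ => by rw [hTD v]]
    simp only [add_mul, Finset.sum_add_distrib, Finset.sum_mul, Finset.mul_sum]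
    rw [Finset.sum_comm, Finset.sum_comm (γ := Fin N)]
    congr 1
    · simp [ite_mul]
    · exact Finset.sum_congr rfl fun u _ => Finset.sum_congr rfl fun v _ => by ring
  -- The defect `D - W D` at `u` is the inhomogeneous term of the differentiated recursion; it
  -- vanishes at terminals, where `expect` is constant.
  have h2 : ∀ u, MTD u * D u - MTD u * ∑ v, B.weight a u v * D v =
      ∑ i, e i * (1 / 2 * match B.cell u with
        | Cell.branch k t f => if k = i then MTD u * (MBU f - MBU t) else 0
        | _ => 0) := by
    intro u
    cases hc : B.cell u with
    | zero =>
      have : B.expect u = fun _ => 0 := funext fun x => by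
        have := B.isBottomUp_expect x u
        rwa [hc] at this
      simp [hD, this, weight, hc]
    | one =>
      have : B.expect u = fun _ => 1 := funext fun x => by
        have := B.isBottomUp_expect x u
        rwa [hc] at this
      simp [hD, this, weight, hc]
    | branch k t f =>
      simp only [weight_branch hc, add_mul, ite_mul, zero_mul, Finset.sum_add_distrib,
        Finset.sum_ite_eq, Finset.mem_univ, if_true, mul_ite, mul_zero]
      simp only [hD, B.fderiv_expect_branch hc, hMBU]
      ring
  have h3 : ∑ j, w j * D (B.entry j) = ∑ u, (MTD u * D u - MTD u * ∑ v, B.weight a u v * D v) := by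
    rw [Finset.sum_sub_distrib, h1]
    ring
  rw [sum_apply]
  simp only [smul_apply, smul_eq_mul]
  rw [show ∑ j, w j * fderiv ℝ (B.expect (B.entry j)) a e = ∑ j, w j * D (B.entry j) from rfl,
    h3, Finset.sum_congr rfl fun u _ => h2 u, Finset.sum_comm]
  simp only [PiLp.inner_apply, combine, ← Finset.mul_sum]
  exact Finset.sum_congr rfl fun i _ => rfl

/-- A node has a single label, so nodes chosen for different variables differ. -/
theorem le_of_occurs (h : ∀ i, B.Occurs i) : n ≤ N := by
  choose v t f hv using h
  have hinj : Function.Injective v := fun i j hij => by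
    have := (hv i).symm.trans (hij ▸ hv j)
    injection this
  simpa using Fintype.card_le_of_injective v hinj

/-- A root determines its function. Used both for the assignment of the initial weights and for `m ≤
N`. -/
theorem Represents.entry_injective {B : MRBDD n m N} {c : Fin m → BoolFun n} (h : B.Represents c)
    (hc : Function.Injective c) : Function.Injective B.entry := fun i j hij =>
  hc (funext fun x => by rw [← h i, ← h j, hij])

end MRBDD

/-! ## The gradient algorithm -/

theorem gradProgram_runs {n m N : ℕ} {B : MRBDD n m N} {a : EuclideanSpace ℝ (Fin n)}
    {w : Fin m → ℝ} {s : Store} (h : s.Holds B a w) (hent : Function.Injective B.entry) :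
    Runs gradProgram s (4000 * N + 2000 * m + 4000 + 100 * n) fun s' =>
      B.IsTopDown a w (s'.vec RArr.mTD N) ∧ B.IsBottomUp a (s'.vec RArr.mBU N) ∧
      ∀ i, s'.vec RArr.g n i =
        1 / 2 * B.combine (s'.vec RArr.mTD N) (s'.vec RArr.mBU N) i := by
  refine Runs.mono (T := (n * 100 + 100) + ((1000 * N + 1000 * m + 1000) +
    ((2000 * N + 1000 * m + 2000) + (N * 100 + 100)))) (Q := fun s' =>
      B.IsTopDown a w (s'.vec RArr.mTD N) ∧ B.IsBottomUp a (s'.vec RArr.mBU N) ∧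
      ∀ i, s'.vec RArr.g n i =
        1 / 2 * B.combine (s'.vec RArr.mTD N) (s'.vec RArr.mBU N) i) ?_ (by omega) fun _ _ h => h
  refine Runs.seq (Runs.forTo_const (s₀ := s) n 100
    (fun k s => ∀ i : Fin n, i < k → s.realArr RArr.g i = 0) (by decide) rfl rfl
    (fun s' hf => (h.frame hf rfl rfl rfl).numVars) (fun v hv => absurd hv (by omega))
    (fun k s' hf hk hI _ v hv => ?_)) fun s₁ hf₁ hs₁ => ?_
  · simp only [run, NExp.eval, RExp.eval, Store.setN_realArr, Store.storeR_realArr, if_true, hk,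
      Function.update_apply]
    split_ifs with hvk
    · simp
    · exact hI v (by omega)
  have h₁ : s₁.Holds B a w := h.frame hf₁ rfl rfl rfl
  refine Runs.seq (evalTopDown_runs h₁ hent) fun s₂ hf₂ hs₂ => ?_
  have h₂ : s₂.Holds B a w := h₁.frame hf₂ rfl rfl rfl
  refine Runs.seq (evalBottomUp_runs h₂) fun s₃ hf₃ hs₃ => ?_
  have h₃ : s₃.Holds B a w := h₂.frame hf₃ rfl rfl rfl
  have hTD : s₃.vec RArr.mTD N = s₂.vec RArr.mTD N := by
    unfold Store.vec
    rw [hf₃.realArr RArr.mTD rfl]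
  rw [← hTD] at hs₂
  -- The last loop does not write the messages, so its summands can be fixed at `s₃`.
  set term : Fin n → Fin N → ℝ := fun i v => match B.cell v with
    | Cell.branch k t f => if k = i then
        s₃.vec RArr.mTD N v * (s₃.vec RArr.mBU N f - s₃.vec RArr.mBU N t) else 0
    | _ => 0 with hterm
  refine Runs.mono (Runs.forTo_const (s₀ := s₃) N 100 (fun k s => ∀ i : Fin n,
    s.realArr RArr.g i =
      1 / 2 * ∑ v ∈ Finset.univ.filter (fun v : Fin N => (v : ℕ) < k), term i v) (by decide)
    rfl rfl (fun s' hf => (h₃.frame hf rfl rfl rfl).numNodes) (fun i => ?_)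
    (fun k s' hf hk hI hkN i => ?_)) le_rfl fun s' hf hs' => ?_
  · simp [hf₃.realArr RArr.g rfl, hf₂.realArr RArr.g rfl, hs₁]
  · obtain ⟨x, rfl⟩ : ∃ x : Fin N, (x : ℕ) = k := ⟨⟨k, hkN⟩, rfl⟩
    have h' : s'.Holds B a w := h₃.frame hf rfl rfl rfl
    rw [filter_lt_succ Fin.val_injective, Finset.sum_insert (by simp), mul_add, add_comm, ← hI,
      run_ifNonterminal h' hk]
    cases hc : B.cell x with
    | zero => simp [hterm, hc]
    | one => simp [hterm, hc]
    | branch l t f =>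
      simp only [incR, run, labelOf, childT, childF, NExp.eval, RExp.eval, hk,
        h'.label x l t f hc, h'.childT x l t f hc, h'.childF x l t f hc, Store.setN_realArr,
        Store.storeR_realArr, if_true, Function.update_apply, Fin.val_inj, hterm, hc, Store.vec,
        hf.realArr RArr.mTD rfl, hf.realArr RArr.mBU rfl, eq_comm (a := i)]
      split_ifs with hl
      · subst hl
        push_cast
        ring
      · simp
  · have hTD' : s'.vec RArr.mTD N = s₃.vec RArr.mTD N := by
      unfold Store.vec
      rw [hf.realArr RArr.mTD rfl]
    have hBU' : s'.vec RArr.mBU N = s₃.vec RArr.mBU N := by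
      unfold Store.vec
      rw [hf.realArr RArr.mBU rfl]
    rw [hTD', hBU']
    refine ⟨hs₂, hs₃, fun i => ?_⟩
    have := hs' i
    rw [Finset.filter_true_of_mem fun u _ => u.isLt] at this
    exact this

end GradBDD
theorem mainTheorem1 :
    ∃ C : ℕ, ∀ (n m N : ℕ) (B : MRBDD n m N) (c : Fin m → BoolFun n) (w : Fin m → ℝ)
      (a : EuclideanSpace ℝ (Fin n)) (s : Store),
      Function.Injective c →
      B.Represents c →
      (∀ i, a i ∈ Set.Icc (-1 : ℝ) 1) →
      s.Holds B a w →
      ∃ (t : ℕ) (s' : Store), Exec gradProgram s t s' ∧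
        HasGradientAt (objective c w) (WithLp.toLp 2 (s'.vec RArr.g n)) a ∧
        B.IsTopDown a w (s'.vec RArr.mTD N) ∧
        B.IsBottomUp a (s'.vec RArr.mBU N) ∧
        (∀ i, s'.vec RArr.g n i =
          1 / 2 * B.combine (s'.vec RArr.mTD N) (s'.vec RArr.mBU N) i) ∧
        t ≤ C * (B.size + n) ∧
        ((∀ i, B.Occurs i) → t ≤ C * B.size) := by
  -- With `m ≤ N` and `1 ≤ N` the bound of `gradProgram_runs` is at most `10000 * N + 100 * n`, so
  -- 20000 is ample, also after `n ≤ N` is used.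
  refine ⟨20000, fun n m N B c w a s hc hB _ hs => ?_⟩
  have hent := hB.entry_injective hc
  obtain ⟨t, s', he, ht, hTD, hBU, hg⟩ := gradProgram_runs hs hent
  have hm : m ≤ N := by simpa using Fintype.card_le_of_injective _ hent
  have hN : 1 ≤ N := B.zero.pos
  refine ⟨t, s', he, ?_, hTD, hBU, hg, ?_, fun hocc => ?_⟩
  · rw [show s'.vec RArr.g n = _ from funext hg]
    exact B.hasGradientAt_objective hB hTD hBU
  · simp only [MRBDD.size]
    omega
  · have := B.le_of_occurs hocc
    simp only [MRBDD.size]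
    omega
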